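/- Conventions. Alphabets are finite; $\lambda$ is the empty word. A (multi-valued partial) function is a map $f:\Sigma^*\to\mathcal P(\Gamma^*)$ for alphabets $\Sigma,\Gamma$; its domain is $\mathrm{dom}(f)=\{x : f(x)\neq\emptyset\}$, and it is single-valued if $|f(x)|\le 1$ for all $x$. A function $f$ is a refinement of $g$ if $\mathrm{dom}(f)=\mathrm{dom}(g)$ and $f(x)\subseteq g(x)$ for all $x$. An npda is a one-way one-head nondeterministic pushdown automaton that reads its input between two endmarkers, may make $\lambda$-moves, and has accepting and rejecting halting states. An npda with output has in addition a write-only output tape, on which each move writes at most one symbol; all its computation paths are required to reach a halting state within $O(n)$ steps on inputs of length $n$. Its valid outputs on $x$ are the words on the output tape at the end of the accepting computation paths on $x$. An oracle npda has in addition a write-only query tape, on which each move writes at most one symbol, and three special states $q_{query},q_{yes},q_{no}$: when it is in state $q_{query}$, the word $s$ on the query tape is sent to the oracle $A$, the query tape is erased, and the next state is $q_{yes}$ if $s\in A$ and $q_{no}$ if $s\notin A$. All computation paths are required to reach a halting state within $O(n)$ steps on inputs of length $n$, no matter what oracle is used. For a language $A$, let $\mathrm{CFL}_T^{A}$ be the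 family of languages recognized by oracle npda's (without output tape) with oracle $A$, let $\mathrm{CFLMV}_T^{A}$ be the class of functions $f$ for which some oracle npda with an output tape has, with oracle $A$, exactly $f(x)$ as its set of valid outputs on every input $x$, and let $\mathrm{CFLSV}_T^{A}$ be the class of single-valued functions in $\mathrm{CFLMV}_T^{A}$. For a language family $\mathcal C$, let $\mathrm{CFL}_T(\mathcal C)$, $\mathrm{CFLMV}_T(\mathcal C)$ and $\mathrm{CFLSV}_T(\mathcal C)$ be the unions of these classes over all $A\in\mathcal C$. Let $\Sigma_1^{\mathrm{CFL}}$ be the family of context-free languages and, for $k\ge1$, let $\Pi_k^{\mathrm{CFL}}$ be the family of complements of the languages in $\Sigma_k^{\mathrm{CFL}}$ and $$\Sigma_{k+1}^{\mathrm{CFL}}=\mathrm{CFL}_T(\Pi_k^{\mathrm{CFL}}),\qquad \Sigma_{k+1}^{\mathrm{CFL}}\mathrm{MV}=\mathrm{CFLMV}_T(\Pi_k^{\mathrm{CFL}}),\qquad \Sigma_{k+1}^{\mathrm{CFL}}\mathrm{SV}=\mathrm{CFLSV}_T(\Pi_k^{\mathrm{CFL}}),$$ where $\Sigma_1^{\mathrm{CFL}}\mathrm{MV}$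 is the class of functions computed by npda's with output, and $\Sigma_1^{\mathrm{CFL}}\mathrm{SV}$ is the class of its single-valued members. Proposition. Let $k\ge 2$. If $\Sigma_k^{\mathrm{CFL}}=\Sigma_{k+1}^{\mathrm{CFL}}$, then $\Sigma_{k+1}^{\mathrm{CFL}}\mathrm{MV}\sqsubseteq_{ref}\Sigma_{k+1}^{\mathrm{CFL}}\mathrm{SV}$, that is, every function in $\Sigma_{k+1}^{\mathrm{CFL}}\mathrm{MV}$ has a (single-valued) refinement in $\Sigma_{k+1}^{\mathrm{CFL}}\mathrm{SV}$. -/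

import Mathlib

namespace CFLHierarchy

/-! ### Machines -/

/-- Cells of the input tape: input symbols together with the two endmarkers. -/
inductive TapeSymbol (σ : Type) : Type
  | leftEnd : TapeSymbol σ
  | rightEnd : TapeSymbol σ
  | letter : σ → TapeSymbol σ

/-- The input tape that carries the word `x` between the endmarkers. -/
def inputTape {σ : Type} (x : List σ) : List (TapeSymbol σ) :=
  TapeSymbol.leftEnd :: (x.map TapeSymbol.letter ++ [TapeSymbol.rightEnd])

/-- A one-way one-head nondeterministic pushdown automaton over the input alphabet `σ`. Each
transition also carries an element of `W` that says what is written on the write-only tapes.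
The first argument of type `Option` of `δ` is the scanned symbol, or `none` for a `λ`-move.
The values of `δ` at halting states are never used. -/
structure PDA (σ W : Type) : Type 1 where
  /-- inner states -/
  Q : Type
  /-- stack alphabet -/
  Θ : Type
  finite_Q : Finite Q
  finite_Θ : Finite Θ
  /-- transition function -/
  δ : Q → Option (TapeSymbol σ) → Θ → Set (Q × List Θ × W)
  finite_δ : ∀ q a Z, (δ q a Z).Finite
  /-- initial state -/
  q₀ : Q
  /-- bottom marker of the stack -/
  Z₀ : Θ
  /-- accepting states -/
  acc : Set Q
  /-- rejecting states -/
  rej : Set Q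
  disjoint_acc_rej : Disjoint acc rej

namespace PDA

variable {σ W : Type}

/-- The halting states. -/
def halt (M : PDA σ W) : Set M.Q := M.acc ∪ M.rej

/-- State, part of the input tape that has not been read yet, and stack (top first). -/
structure Cfg (M : PDA σ W) : Type where
  state : M.Q
  input : List (TapeSymbol σ)
  stack : List M.Θ

/-- The initial configuration on input `x`. -/
def start (M : PDA σ W) (x : List σ) : M.Cfg := ⟨M.q₀, inputTape x, [M.Z₀]⟩

/-- `M.Move c w c'`: a transition out of a non-halting state leads from `c` to `c'` and
writes `w`. It reads one tape symbol or none (`λ`-move), and it replaces the topmost stack symbol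
by a word. -/
def Move (M : PDA σ W) (c : M.Cfg) (w : W) (c' : M.Cfg) : Prop :=
  c.state ∉ M.halt ∧
    ∃ (a : Option (TapeSymbol σ)) (Z : M.Θ) (u s : List M.Θ),
      c.input = a.toList ++ c'.input ∧
      c.stack = Z :: s ∧ c'.stack = u ++ s ∧
      (c'.state, u, w) ∈ M.δ c.state a Z

end PDA

/-- All computation paths from `c` reach a halted configuration within `t` steps; in particular
no path gets stuck in a configuration that is not halted. -/
def HaltsWithin {C : Type} (step : C → C → Prop) (halted : C → Prop) : ℕ → C → Prop
  | 0, c => halted c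
  | t + 1, c =>
      halted c ∨ ((∃ d, step c d) ∧ ∀ d, step c d → HaltsWithin step halted t d)

/-! ### Machines with an output tape -/

/-- An npda with a write-only output tape over `γ`; each move writes one symbol or none. -/
abbrev Transducer (σ γ : Type) : Type 1 := PDA σ (Option γ)

namespace Transducer

variable {σ γ : Type}

/-- One step; configurations are paired with the content of the output tape. -/
def Step (M : Transducer σ γ) (c d : PDA.Cfg M × List γ) : Prop :=
  ∃ w : Option γ, PDA.Move M c.1 w d.1 ∧ d.2 = c.2 ++ w.toList

/-- All computation paths on inputs of length `n` halt in `O(n)` steps. -/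
def LinearTime (M : Transducer σ γ) : Prop :=
  ∃ a b : ℕ, ∀ x : List σ,
    HaltsWithin (Step M) (fun c => c.1.state ∈ PDA.halt M) (a * x.length + b)
      (PDA.start M x, [])

/-- The set of valid outputs on input `x`: those produced along accepting computation paths. -/
def outputs (M : Transducer σ γ) (x : List σ) : Set (List γ) :=
  {z | ∃ c : PDA.Cfg M, c.state ∈ M.acc ∧
    Relation.ReflTransGen (Step M) (PDA.start M x, []) (c, z)}

end Transducer

/-! ### Oracle machines -/

/-- An npda with a write-only output tape over `γ` and a write-only query tape over `β`; each move
writes at most one symbol on each of them. It has three special states for its queries. The values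
of `δ` at the query state are never used. -/
structure OracleNPDA (σ γ β : Type) : Type 1 extends PDA σ (Option γ × Option β) where
  qQuery : Q
  qYes : Q
  qNo : Q
  query_ne_yes : qQuery ≠ qYes
  query_ne_no : qQuery ≠ qNo
  yes_ne_no : qYes ≠ qNo
  query_not_halt : qQuery ∉ acc ∪ rej
  yes_not_halt : qYes ∉ acc ∪ rej
  no_not_halt : qNo ∉ acc ∪ rej

namespace OracleNPDA

variable {σ γ β : Type}

/-- A configuration of the automaton with the contents of the query tape and the output tape. -/
structure OCfg (M : OracleNPDA σ γ β) : Type where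
  cfg : M.toPDA.Cfg
  query : List β
  output : List γ

/-- The initial configuration on input `x`. -/
def start (M : OracleNPDA σ γ β) (x : List σ) : M.OCfg := ⟨M.toPDA.start x, [], []⟩

/-- One step relative to the oracle `A`. In the query state the word on the query tape is sent to
the oracle, the query tape is erased, and the answer determines the next state. -/
inductive Step (M : OracleNPDA σ γ β) (A : Language β) : M.OCfg → M.OCfg → Prop
  | move (c d : M.toPDA.Cfg) (y : List β) (z : List γ) (w : Option γ × Option β)
      (hq : c.state ≠ M.qQuery) (hm : M.toPDA.Move c w d) :
      Step M A ⟨c, y, z⟩ ⟨d, y ++ w.2.toList, z ++ w.1.toList⟩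
  | yes (c : M.toPDA.Cfg) (y : List β) (z : List γ)
      (hq : c.state = M.qQuery) (hy : y ∈ A) :
      Step M A ⟨c, y, z⟩ ⟨⟨M.qYes, c.input, c.stack⟩, [], z⟩
  | no (c : M.toPDA.Cfg) (y : List β) (z : List γ)
      (hq : c.state = M.qQuery) (hy : y ∉ A) :
      Step M A ⟨c, y, z⟩ ⟨⟨M.qNo, c.input, c.stack⟩, [], z⟩

/-- All computation paths on inputs of length `n` halt in `O(n)` steps, no matter what oracle is
used. -/
def LinearTime (M : OracleNPDA σ γ β) : Prop :=
  ∃ a b : ℕ, ∀ (A : Language β) (x : List σ),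
    HaltsWithin (M.Step A) (fun c => c.cfg.state ∈ M.toPDA.halt) (a * x.length + b) (M.start x)

/-- The set of valid outputs on input `x` relative to the oracle `A`. -/
def outputs (M : OracleNPDA σ γ β) (A : Language β) (x : List σ) : Set (List γ) :=
  {z | ∃ c : M.OCfg, c.cfg.state ∈ M.acc ∧ c.output = z ∧
    Relation.ReflTransGen (M.Step A) (M.start x) c}

/-- The machine accepts the input `x` relative to the oracle `A`. -/
def Accepts (M : OracleNPDA σ γ β) (A : Language β) (x : List σ) : Prop :=
  ∃ c : M.OCfg, c.cfg.state ∈ M.acc ∧ Relation.ReflTransGen (M.Step A) (M.start x) c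

end OracleNPDA

/-! ### Language families and the CFL hierarchy -/

/-- A family of languages over finite alphabets. -/
abbrev LanguageFamily : Type 1 := (σ : Type) → [Finite σ] → Set (Language σ)

/-- The family of context-free languages. -/
def CFL : LanguageFamily := fun _ _ => {L | L.IsContextFree}

/-- The family of complements of the languages in `𝒞`. -/
def coFamily (𝒞 : LanguageFamily) : LanguageFamily := fun σ _ => {L | Lᶜ ∈ 𝒞 σ}

/-- Languages recognized relative to `A` by linear-time oracle npda's. These machines have no
output tape: the output alphabet is empty. -/
def CFLT {β : Type} (A : Language β) : LanguageFamily := fun σ _ =>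
  {L | ∃ M : OracleNPDA σ Empty β, M.LinearTime ∧ ∀ x, x ∈ L ↔ M.Accepts A x}

/-- The union of `CFLT A` over all `A` in `𝒞`. -/
def CFLTFamily (𝒞 : LanguageFamily) : LanguageFamily := fun σ _ =>
  {L | ∃ (β : Type) (_ : Finite β) (A : Language β), A ∈ 𝒞 β ∧ L ∈ CFLT A σ}

/-- The levels `Σ_k` of the CFL hierarchy for `k ≥ 1`; index `0` is not used. -/
def SigmaCFL : ℕ → LanguageFamily
  | 0 => fun _ _ => ∅
  | 1 => CFL
  | k + 2 => CFLTFamily (coFamily (SigmaCFL (k + 1)))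

/-- The levels `Π_k` of the CFL hierarchy for `k ≥ 1`. -/
def PiCFL (k : ℕ) : LanguageFamily := coFamily (SigmaCFL k)

/-! ### Multi-valued partial functions -/

/-- Multi-valued partial functions from words over `σ` to words over `γ`. -/
abbrev MVFun (σ γ : Type) : Type := List σ → Set (List γ)

namespace MVFun

variable {σ γ : Type}

/-- The domain of definition. -/
def dom (f : MVFun σ γ) : Set (List σ) := {x | (f x).Nonempty}

/-- At most one value at every word. -/
def SingleValued (f : MVFun σ γ) : Prop := ∀ x, (f x).Subsingleton

/-- `f` is a refinement of `g`. -/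
def IsRefinementOf (f g : MVFun σ γ) : Prop := dom f = dom g ∧ ∀ x, f x ⊆ g x

end MVFun

/-- A class of multi-valued partial functions between words over finite alphabets. -/
abbrev FunctionClass : Type 1 :=
  (σ γ : Type) → [Finite σ] → [Finite γ] → Set (MVFun σ γ)

/-- The single-valued functions of a class. -/
def FunctionClass.singleValued (𝓕 : FunctionClass) : FunctionClass := fun σ γ _ _ =>
  {f | f ∈ 𝓕 σ γ ∧ MVFun.SingleValued f}

/-- Every function in `𝓖` is refined by some function in `𝓕`. -/
def FunctionClass.RefinedBy (𝓖 𝓕 : FunctionClass) : Prop :=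
  ∀ (σ γ : Type) [Finite σ] [Finite γ] (g : MVFun σ γ), g ∈ 𝓖 σ γ →
    ∃ f : MVFun σ γ, f ∈ 𝓕 σ γ ∧ MVFun.IsRefinementOf f g

/-- Functions computed by linear-time npda's with an output tape. -/
def CFLMV : FunctionClass := fun σ γ _ _ =>
  {f | ∃ M : Transducer σ γ, Transducer.LinearTime M ∧ ∀ x, f x = Transducer.outputs M x}

/-- Functions computed relative to `A` by linear-time oracle npda's with an output tape. -/
def CFLMVT {β : Type} (A : Language β) : FunctionClass := fun σ γ _ _ =>
  {f | ∃ M : OracleNPDA σ γ β, M.LinearTime ∧ ∀ x, f x = M.outputs A x}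

/-- The single-valued functions in `CFLMV`. -/
def CFLSV : FunctionClass := FunctionClass.singleValued CFLMV

/-- The single-valued functions in `CFLMVT A`. -/
def CFLSVT {β : Type} (A : Language β) : FunctionClass := FunctionClass.singleValued (CFLMVT A)

/-- The union of `CFLMVT A` over all `A` in `𝒞`. -/
def CFLMVTFamily (𝒞 : LanguageFamily) : FunctionClass := fun σ γ _ _ =>
  {f | ∃ (β : Type) (_ : Finite β) (A : Language β), A ∈ 𝒞 β ∧ f ∈ CFLMVT A σ γ}

/-- The union of `CFLSVT A` over all `A` in `𝒞`. -/
def CFLSVTFamily (𝒞 : LanguageFamily) : FunctionClass := fun σ γ _ _ =>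
  {f | ∃ (β : Type) (_ : Finite β) (A : Language β), A ∈ 𝒞 β ∧ f ∈ CFLSVT A σ γ}

/-- The classes `Σ_k MV` for `k ≥ 1`; index `0` is not used. -/
def SigmaCFLMV : ℕ → FunctionClass
  | 0 => fun _ _ _ _ => ∅
  | 1 => CFLMV
  | k + 2 => CFLMVTFamily (PiCFL (k + 1))

/-- The classes `Σ_k SV` for `k ≥ 1`; index `0` is not used. -/
def SigmaCFLSV : ℕ → FunctionClass
  | 0 => fun _ _ _ _ => ∅
  | 1 => CFLSV
  | k + 2 => CFLSVTFamily (PiCFL (k + 1))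

end CFLHierarchy

/-!
Fix an oracle machine `M` with oracle `A`. Another oracle machine can guess a computation path of
`M`, writing the code of the path on its query tape and the output of the path on its output tape,
and then ask a single query: is this the lexicographically least accepting path on its input? Only
one path survives, so the function computed is single-valued, and it refines the function of `M`.

A nondeterministic pushdown machine with oracle `A` recognizes the codes that must be refused. It
follows the path while reading its code, and accepts either at an error in the code or by leaving
the path at some point with a smaller step and completing the rival path; the code contains the
input of `M`, so the rival path can be run on the remainder of the code. Hence the query language
is the complement of a language in `CFL_T(A)`, and a collapse of the hierarchy brings it down to
the level of `A`. The machine that guesses uses its stack as a clock to stop after linearly many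
steps.
-/

namespace CFLHierarchy

/-! ### Oracle programs -/

section HaltsWithin

variable {C : Type} {step : C → C → Prop} {halted : C → Prop} {t t' : ℕ} {c d : C}

theorem HaltsWithin.of_halted (h : halted c) : ∀ t, HaltsWithin step halted t c
  | 0 => h
  | _ + 1 => .inl h

theorem HaltsWithin.mono (ht : t ≤ t') (h : HaltsWithin step halted t c) :
    HaltsWithin step halted t' c := by
  induction t generalizing t' c with
  | zero => exact .of_halted h t'
  | succ t ih =>
    obtain ⟨t', rfl⟩ := Nat.exists_eq_add_of_lt ht
    exact h.imp_right fun ⟨hc, h⟩ => ⟨hc, fun d hd => ih (by omega) (h d hd)⟩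

theorem HaltsWithin.of_forall_step (hc : halted c ∨ ∃ d, step c d)
    (h : ∀ d, step c d → ∃ t' < t, HaltsWithin step halted t' d) :
    HaltsWithin step halted t c := by
  rcases hc with hc | ⟨d, hd⟩
  · exact .of_halted hc t
  obtain _ | t := t
  · obtain ⟨t', ht', -⟩ := h d hd
    exact absurd ht' t'.not_lt_zero
  · refine .inr ⟨⟨d, hd⟩, fun e he => ?_⟩
    obtain ⟨t', ht', h⟩ := h e he
    exact h.mono (Nat.le_of_lt_succ ht')

theorem HaltsWithin.of_step (hc : ∀ c d, halted c → ¬ step c d)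
    (h : HaltsWithin step halted t c) (hd : step c d) :
    ∃ t' < t, HaltsWithin step halted t' d := by
  obtain _ | t := t
  · exact absurd hd (hc c d h)
  · exact ⟨t, t.lt_succ_self, (h.resolve_left fun h => hc c d h hd).2 d hd⟩

/-- Configurations without a successor: the notion of halting for machines that may get stuck. -/
def Stuck (step : C → C → Prop) (c : C) : Prop := ∀ d, ¬ step c d

theorem haltsWithin_stuck_iff : HaltsWithin step (Stuck step) t c ↔
    ∀ d, step c d → ∃ t' < t, HaltsWithin step (Stuck step) t' d := by
  refine ⟨fun h d hd => h.of_step (fun _ d h => h d) hd, fun h => .of_forall_step ?_ h⟩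
  by_cases hc : ∃ d, step c d
  · exact .inr hc
  · exact .inl (not_exists.1 hc)

theorem haltsWithin_stuck_of_potential (φ : C → ℕ) (hφ : ∀ c d, step c d → φ d < φ c) (c : C) :
    HaltsWithin step (Stuck step) (φ c) c := by
  induction hn : φ c using Nat.strong_induction_on generalizing c with
  | _ n ih =>
    subst hn
    exact haltsWithin_stuck_iff.2 fun d hd => ⟨φ d, hφ c d hd, ih _ (hφ c d hd) d rfl⟩

end HaltsWithin

instance {σ : Type} [Finite σ] : Finite (TapeSymbol σ) :=
  Set.finite_univ_iff.1 <|
    (Set.toFinite ({.leftEnd, .rightEnd} ∪ Set.range .letter)).subset fun s _ => by cases s <;> simp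

theorem OracleNPDA.Step.of_move_none {σ γ β : Type} {M : OracleNPDA σ γ β} {A : Language β}
    {c d : M.toPDA.Cfg} {y : List β} {z : List γ} (hq : c.state ≠ M.qQuery)
    (hm : M.toPDA.Move c (none, none) d) : M.Step A ⟨c, y, z⟩ ⟨d, y, z⟩ := by
  simpa using OracleNPDA.Step.move (A := A) c d y z _ hq hm

/-- A more convenient form of oracle npda's: the stack starts out empty, a move may test whether
it is empty, a query does not destroy the inner state, and computation paths may get stuck. -/
structure OracleProgram (σ γ β : Type) : Type 1 where
  Q : Type
  Θ : Type
  finite_Q : Finite Q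
  finite_Θ : Finite Θ
  /-- transition function; its third argument is `none` when the stack is empty -/
  δ : Q → Option (TapeSymbol σ) → Option Θ → Set (Q × List Θ × (Option γ × Option β))
  finite_δ : ∀ q a Z, (δ q a Z).Finite
  q₀ : Q
  acc : Set Q
  /-- the query states, each with the next state as a function of the answer -/
  ask : Q → Option (Bool → Q)

namespace OracleProgram

variable {σ γ β : Type}

/-- A configuration of a program with the contents of all its tapes. -/
structure Cfg (P : OracleProgram σ γ β) : Type where
  state : P.Q
  input : List (TapeSymbol σ)
  stack : List P.Θ
  query : List β
  output : List γ

/-- The initial configuration on input `x`. -/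
def start (P : OracleProgram σ γ β) (x : List σ) : P.Cfg := ⟨P.q₀, inputTape x, [], [], []⟩

/-- One step relative to the oracle `A`. Accepting states are final. -/
inductive Step (P : OracleProgram σ γ β) (A : Language β) : P.Cfg → P.Cfg → Prop
  | move {q : P.Q} {i : List (TapeSymbol σ)} {s : List P.Θ} {y : List β} {z : List γ}
      {a : Option (TapeSymbol σ)} {q' : P.Q} {u : List P.Θ} {w : Option γ × Option β}
      (hacc : q ∉ P.acc) (hask : P.ask q = none) (hδ : (q', u, w) ∈ P.δ q a s.head?) :
      Step P A ⟨q, a.toList ++ i, s, y, z⟩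
        ⟨q', i, u ++ s.tail, y ++ w.2.toList, z ++ w.1.toList⟩
  | ask {q : P.Q} {i : List (TapeSymbol σ)} {s : List P.Θ} {y : List β} {z : List γ}
      {r : Bool → P.Q} {b : Bool} (hacc : q ∉ P.acc) (hask : P.ask q = some r)
      (hb : b = true ↔ y ∈ A) : Step P A ⟨q, i, s, y, z⟩ ⟨r b, i, s, [], z⟩

/-- All computation paths on inputs of length `n` have length `O(n)`, no matter what oracle is
used. -/
def LinearTime (P : OracleProgram σ γ β) : Prop :=
  ∃ a b : ℕ, ∀ (A : Language β) (x : List σ),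
    HaltsWithin (P.Step A) (Stuck (P.Step A)) (a * x.length + b) (P.start x)

/-- The set of valid outputs on input `x` relative to the oracle `A`. -/
def outputs (P : OracleProgram σ γ β) (A : Language β) (x : List σ) : Set (List γ) :=
  {z | ∃ c : P.Cfg, c.state ∈ P.acc ∧ c.output = z ∧
    Relation.ReflTransGen (P.Step A) (P.start x) c}

theorem Step.notMem_acc {P : OracleProgram σ γ β} {A : Language β} {c d : P.Cfg}
    (h : P.Step A c d) : c.state ∉ P.acc := by
  cases h <;> assumption

theorem Step.exists_move {P : OracleProgram σ γ β} {A : Language β} {c d : P.Cfg}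
    (h : P.Step A c d) (hask : P.ask c.state = none) :
    ∃ a i, c.input = Option.toList a ++ i ∧ ∃ v ∈ P.δ c.state a c.stack.head?,
      d = ⟨v.1, i, v.2.1 ++ c.stack.tail, c.query ++ v.2.2.2.toList,
        c.output ++ v.2.2.1.toList⟩ := by
  cases h with
  | move _ _ hδ => exact ⟨_, _, rfl, _, hδ, rfl⟩
  | ask _ hask' => exact absurd (hask.symm.trans hask') nofun

theorem Step.exists_answer {P : OracleProgram σ γ β} {A : Language β} {c d : P.Cfg}
    {r : Bool → P.Q} (h : P.Step A c d) (hask : P.ask c.state = some r) :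
    ∃ b : Bool, (b = true ↔ c.query ∈ A) ∧ d = ⟨r b, c.input, c.stack, [], c.output⟩ := by
  cases h with
  | move _ hask' => exact absurd (hask.symm.trans hask') nofun
  | ask _ hask' hb =>
    obtain rfl := Option.some.inj (hask.symm.trans hask')
    exact ⟨_, hb, rfl⟩

theorem cfg_replace_head? {P : OracleProgram σ γ β} (q : P.Q) (i : List (TapeSymbol σ))
    (c : P.Cfg) : (⟨q, i, c.stack.head?.toList ++ c.stack.tail, c.query ++ [], c.output ++ []⟩ :
      P.Cfg) = ⟨q, i, c.stack, c.query, c.output⟩ := by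
  cases h : c.stack <;> simp

theorem Step.of_silent {P : OracleProgram σ γ β} {A : Language β} {c : P.Cfg} {q : P.Q}
    {a : Option (TapeSymbol σ)} {i : List (TapeSymbol σ)} (hacc : c.state ∉ P.acc)
    (hask : P.ask c.state = none) (hi : c.input = a.toList ++ i)
    (hδ : (q, c.stack.head?.toList, (none, none)) ∈ P.δ c.state a c.stack.head?) :
    P.Step A c ⟨q, i, c.stack, c.query, c.output⟩ := by
  have := Step.move (A := A) (i := i) (y := c.query) (z := c.output) hacc hask hδ
  rwa [← hi, Option.toList_none, Option.toList_none, cfg_replace_head?] at this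

/-- Some computation path from `c` ends in an accepting state. -/
def AcceptsFrom (P : OracleProgram σ γ β) (A : Language β) (c : P.Cfg) : Prop :=
  ∃ d : P.Cfg, d.state ∈ P.acc ∧ Relation.ReflTransGen (P.Step A) c d

theorem AcceptsFrom.head {P : OracleProgram σ γ β} {A : Language β} {c d : P.Cfg}
    (hd : P.AcceptsFrom A d) (h : P.Step A c d) : P.AcceptsFrom A c :=
  let ⟨e, he, hd⟩ := hd
  ⟨e, he, hd.head h⟩

theorem AcceptsFrom.exists_step {P : OracleProgram σ γ β} {A : Language β} {c : P.Cfg}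
    (hc : P.AcceptsFrom A c) (hacc : c.state ∉ P.acc) : ∃ d, P.Step A c d ∧ P.AcceptsFrom A d := by
  obtain ⟨e, he, h⟩ := hc
  rcases h.cases_head with rfl | ⟨d, hd, h⟩
  · exact absurd he hacc
  · exact ⟨d, hd, e, he, h⟩

theorem acceptsFrom_start_iff {P : OracleProgram σ γ β} {A : Language β} {x : List σ} :
    P.AcceptsFrom A (P.start x) ↔ (P.outputs A x).Nonempty :=
  ⟨fun ⟨c, hc, h⟩ => ⟨c.output, c, hc, rfl, h⟩, fun ⟨_, c, hc, _, h⟩ => ⟨c, hc, h⟩⟩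

/-- States of the automaton that simulates a program: those of the program, the three states that
handle queries, and a rejecting state. -/
inductive SimState (Q : Type) : Type
  | run (q : Q)
  | query
  | answer (b : Bool)
  | reject

/-- Stack symbols of the automaton that simulates a program: a bottom marker, the stack symbols
of the program, and the states that ask queries, to be remembered during the query. -/
inductive SimSymbol (Q Θ : Type) : Type
  | bottom
  | symbol (Z : Θ)
  | caller (q : Q)

instance {Q : Type} [Finite Q] : Finite (SimState Q) :=
  Set.finite_univ_iff.1 <|
    (Set.toFinite ({.query, .reject} ∪ Set.range .run ∪ Set.range .answer)).subset
      fun s _ => by cases s <;> simp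

instance {Q Θ : Type} [Finite Q] [Finite Θ] : Finite (SimSymbol Q Θ) :=
  Set.finite_univ_iff.1 <|
    (Set.toFinite ({.bottom} ∪ Set.range .symbol ∪ Set.range .caller)).subset
      fun Z _ => by cases Z <;> simp

/-- What a program sees when the simulating automaton scans a symbol of its own stack. -/
def SimSymbol.top {Q Θ : Type} : SimSymbol Q Θ → Option Θ
  | symbol Z => some Z
  | _ => none

/-- The part of a replacement word that restores the bottom marker. -/
def SimSymbol.kept {Q Θ : Type} : SimSymbol Q Θ → List (SimSymbol Q Θ)
  | symbol _ => []
  | Z => [Z]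

/-- The transitions of the automaton that simulates `P`. A query takes the detour through `caller`
because it leads to the same states whoever asks it; giving up keeps the automaton from getting
stuck. -/
inductive SimMove (P : OracleProgram σ γ β) :
    SimState P.Q → Option (TapeSymbol σ) → SimSymbol P.Q P.Θ →
      SimState P.Q × List (SimSymbol P.Q P.Θ) × (Option γ × Option β) → Prop
  | giveUp (s : SimState P.Q) (Z : SimSymbol P.Q P.Θ) :
      SimMove P s none Z (.reject, [Z], (none, none))
  | move {q : P.Q} {a : Option (TapeSymbol σ)} {Z : SimSymbol P.Q P.Θ} {q' : P.Q}
      {u : List P.Θ} {w : Option γ × Option β} (hask : P.ask q = none)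
      (hδ : (q', u, w) ∈ P.δ q a Z.top) :
      SimMove P (.run q) a Z (.run q', u.map .symbol ++ Z.kept, w)
  | call {q : P.Q} {r : Bool → P.Q} (Z : SimSymbol P.Q P.Θ) (hask : P.ask q = some r) :
      SimMove P (.run q) none Z (.query, [.caller q, Z], (none, none))
  | resume {q : P.Q} {r : Bool → P.Q} (b : Bool) (hask : P.ask q = some r) :
      SimMove P (.answer b) none (.caller q) (.run (r b), [], (none, none))

theorem finite_simMove (P : OracleProgram σ γ β) (s : SimState P.Q) (a : Option (TapeSymbol σ))
    (Z : SimSymbol P.Q P.Θ) : {v | SimMove P s a Z v}.Finite := by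
  have := P.finite_Q
  have hmove := (Set.finite_iUnion fun q => P.finite_δ q a Z.top).image fun v =>
    (SimState.run v.1, v.2.1.map SimSymbol.symbol ++ Z.kept, v.2.2)
  have hcall := Set.finite_range fun q : P.Q =>
    (SimState.query (Q := P.Q), [SimSymbol.caller q, Z], ((none, none) : Option γ × Option β))
  have hresume := Set.finite_range fun q : P.Q =>
    (SimState.run q, ([] : List (SimSymbol P.Q P.Θ)), ((none, none) : Option γ × Option β))
  refine (((hmove.union hcall).union hresume).insert (.reject, [Z], (none, none))).subset ?_
  intro v hv
  cases hv with
  | giveUp => exact .inl rfl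
  | move _ hδ => exact .inr (.inl (.inl ⟨_, Set.mem_iUnion.2 ⟨_, hδ⟩, rfl⟩))
  | call => exact .inr (.inl (.inr ⟨_, rfl⟩))
  | resume => exact .inr (.inr ⟨_, rfl⟩)

/-- The oracle npda that simulates `P`. -/
abbrev toOracleNPDA (P : OracleProgram σ γ β) : OracleNPDA σ γ β where
  Q := SimState P.Q
  Θ := SimSymbol P.Q P.Θ
  finite_Q := have := P.finite_Q; inferInstance
  finite_Θ := have := P.finite_Q; have := P.finite_Θ; inferInstance
  δ s a Z := {v | SimMove P s a Z v}
  finite_δ := P.finite_simMove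
  q₀ := .run P.q₀
  Z₀ := .bottom
  acc := SimState.run '' P.acc
  rej := {.reject}
  disjoint_acc_rej := by simp
  qQuery := .query
  qYes := .answer true
  qNo := .answer false
  query_ne_yes := by simp
  query_ne_no := by simp
  yes_ne_no := by simp
  query_not_halt := by simp
  yes_not_halt := by simp
  no_not_halt := by simp

variable {P : OracleProgram σ γ β} {A : Language β}

/-- The stack of the simulating automaton. -/
def simStack (P : OracleProgram σ γ β) (s : List P.Θ) : List (SimSymbol P.Q P.Θ) :=
  s.map .symbol ++ [.bottom]

theorem exists_simStack_eq (s : List P.Θ) : ∃ Z t, P.simStack s = Z :: t ∧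
    Z.top = s.head? ∧ ∀ u, u.map .symbol ++ Z.kept ++ t = P.simStack (u ++ s.tail) := by
  cases s with
  | nil => exact ⟨.bottom, [], rfl, rfl, fun u => by simp [simStack, SimSymbol.kept]⟩
  | cons Z s => exact ⟨.symbol Z, P.simStack s, rfl, rfl, fun u => by
      simp [simStack, SimSymbol.kept]⟩

/-- The configuration of the simulating automaton that represents `c`. -/
def simCfg (P : OracleProgram σ γ β) (c : P.Cfg) : P.toOracleNPDA.OCfg :=
  ⟨⟨.run c.state, c.input, P.simStack c.stack⟩, c.query, c.output⟩

/-- The configuration of the simulating automaton that is about to ask the query of `c`. -/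
def queryCfg (P : OracleProgram σ γ β) (c : P.Cfg) : P.toOracleNPDA.OCfg :=
  ⟨⟨.query, c.input, .caller c.state :: P.simStack c.stack⟩, c.query, c.output⟩

/-- The configuration of the simulating automaton in which the query of `c` has been answered. -/
def answerCfg (P : OracleProgram σ γ β) (c : P.Cfg) (b : Bool) : P.toOracleNPDA.OCfg :=
  ⟨⟨.answer b, c.input, .caller c.state :: P.simStack c.stack⟩, [], c.output⟩

theorem run_mem_halt_iff {q : P.Q} :
    SimState.run q ∈ P.toOracleNPDA.toPDA.halt ↔ q ∈ P.acc := by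
  simp [PDA.halt]

theorem answer_notMem_halt (b : Bool) : SimState.answer b ∉ P.toOracleNPDA.toPDA.halt := by
  simp [PDA.halt]

theorem step_simCfg_of_move {q q' : P.Q} {i : List (TapeSymbol σ)} {s u : List P.Θ} {y : List β}
    {z : List γ} {a : Option (TapeSymbol σ)} {w : Option γ × Option β} (hacc : q ∉ P.acc)
    (hask : P.ask q = none) (hδ : (q', u, w) ∈ P.δ q a s.head?) :
    P.toOracleNPDA.Step A (P.simCfg ⟨q, a.toList ++ i, s, y, z⟩)
      (P.simCfg ⟨q', i, u ++ s.tail, y ++ w.2.toList, z ++ w.1.toList⟩) := by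
  obtain ⟨Z, t, hs, htop, hkept⟩ := P.exists_simStack_eq s
  exact .move _ _ _ _ w (fun h => by cases h) ⟨run_mem_halt_iff.not.2 hacc, a, Z, _, t, rfl, hs,
    (hkept u).symm, .move hask (htop ▸ hδ)⟩

theorem step_simCfg_queryCfg {c : P.Cfg} {r : Bool → P.Q} (hacc : c.state ∉ P.acc)
    (hask : P.ask c.state = some r) : P.toOracleNPDA.Step A (P.simCfg c) (P.queryCfg c) := by
  obtain ⟨Z, t, hs, -⟩ := P.exists_simStack_eq c.stack
  have hmove : P.toOracleNPDA.toPDA.Move (P.simCfg c).cfg (none, none) (P.queryCfg c).cfg :=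
    ⟨run_mem_halt_iff.not.2 hacc, none, Z, [.caller c.state, Z], t, rfl, hs,
      congrArg _ hs, .call Z hask⟩
  exact .of_move_none (fun h => by cases h) hmove

theorem step_queryCfg_answerCfg {c : P.Cfg} {b : Bool} (hb : b = true ↔ c.query ∈ A) :
    P.toOracleNPDA.Step A (P.queryCfg c) (P.answerCfg c b) := by
  cases b with
  | true => exact .yes _ _ _ rfl (hb.1 rfl)
  | false => exact .no _ _ _ rfl (by simpa using hb)

theorem step_answerCfg_simCfg {c : P.Cfg} {r : Bool → P.Q} (b : Bool)
    (hask : P.ask c.state = some r) :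
    P.toOracleNPDA.Step A (P.answerCfg c b)
      (P.simCfg ⟨r b, c.input, c.stack, [], c.output⟩) := by
  have hmove : P.toOracleNPDA.toPDA.Move (P.answerCfg c b).cfg (none, none)
      (P.simCfg ⟨r b, c.input, c.stack, [], c.output⟩).cfg :=
    ⟨answer_notMem_halt b, none, .caller c.state, [], _, rfl, rfl, rfl, .resume b hask⟩
  exact .of_move_none (fun h => by cases h) hmove

theorem reflTransGen_simCfg {c d : P.Cfg} (h : Relation.ReflTransGen (P.Step A) c d) :
    Relation.ReflTransGen (P.toOracleNPDA.Step A) (P.simCfg c) (P.simCfg d) := by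
  induction h with
  | refl => rfl
  | tail _ hstep ih =>
    refine ih.trans ?_
    cases hstep with
    | move hacc hask hδ => exact .single (step_simCfg_of_move hacc hask hδ)
    | @ask q i s y z r b hacc hask hb =>
      exact ((Relation.ReflTransGen.single (step_simCfg_queryCfg hacc hask)).tail
        (step_queryCfg_answerCfg hb)).tail (step_answerCfg_simCfg b hask)

/-- `Simulates A C c m`: the automaton in configuration `C` is simulating the next step of the
program in configuration `c`, or has given up doing so, and can make at most `m` moves before that
step is completed. -/
inductive Simulates (A : Language β) : P.toOracleNPDA.OCfg → P.Cfg → ℕ → Prop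
  | run (c : P.Cfg) : Simulates A (P.simCfg c) c 3
  | query {c : P.Cfg} {r : Bool → P.Q} (hacc : c.state ∉ P.acc)
      (hask : P.ask c.state = some r) : Simulates A (P.queryCfg c) c 2
  | answer {c : P.Cfg} {r : Bool → P.Q} {b : Bool} (hacc : c.state ∉ P.acc)
      (hask : P.ask c.state = some r) (hb : b = true ↔ c.query ∈ A) :
      Simulates A (P.answerCfg c b) c 1
  | reject {C : P.toOracleNPDA.OCfg} (c : P.Cfg) (hC : C.cfg.state = .reject) : Simulates A C c 0

theorem step_simCfg {c : P.Cfg} {D : P.toOracleNPDA.OCfg}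
    (h : P.toOracleNPDA.Step A (P.simCfg c) D) :
    (∃ m < 3, Simulates A D c m) ∨ ∃ d, P.Step A c d ∧ D = P.simCfg d := by
  obtain ⟨q, i, s, y, z⟩ := c
  obtain ⟨Z, t, hs, htop, hkept⟩ := P.exists_simStack_eq s
  cases h with
  | yes _ _ _ hq | no _ _ _ hq => cases hq
  | move _ d _ _ w _ hm =>
    obtain ⟨q', i', s'⟩ := d
    obtain ⟨hacc, a, Z', u, t', rfl : i = _, hs' : P.simStack s = _, rfl : s' = _, hδ⟩ := hm
    rw [hs, List.cons.injEq] at hs'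
    obtain ⟨rfl, rfl⟩ := hs'
    replace hacc : q ∉ P.acc := run_mem_halt_iff.not.1 hacc
    replace hδ : SimMove P (.run q) a Z (q', u, w) := hδ
    cases hδ with
    | giveUp => exact .inl ⟨0, by simp, .reject _ rfl⟩
    | move hask hδ =>
      refine .inr ⟨_, .move hacc hask (htop ▸ hδ), ?_⟩
      rw [hkept]
      rfl
    | call _ hask =>
      refine .inl ⟨2, by simp, ?_⟩
      simpa [queryCfg, hs] using Simulates.query (A := A) (c := ⟨q, i', s, y, z⟩) hacc hask

theorem step_queryCfg {c : P.Cfg} {D : P.toOracleNPDA.OCfg}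
    (h : P.toOracleNPDA.Step A (P.queryCfg c) D) :
    ∃ b : Bool, (b = true ↔ c.query ∈ A) ∧ D = P.answerCfg c b := by
  cases h with
  | move _ _ _ _ _ hq => exact absurd rfl hq
  | yes _ _ _ _ hy => exact ⟨true, by simpa using hy, rfl⟩
  | no _ _ _ _ hy => exact ⟨false, by simpa using hy, rfl⟩

theorem step_answerCfg {c : P.Cfg} {r : Bool → P.Q} {b : Bool} {D : P.toOracleNPDA.OCfg}
    (hask : P.ask c.state = some r) (h : P.toOracleNPDA.Step A (P.answerCfg c b) D) :
    Simulates A D c 0 ∨ D = P.simCfg ⟨r b, c.input, c.stack, [], c.output⟩ := by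
  cases h with
  | yes _ _ _ hq | no _ _ _ hq => cases hq
  | move _ d _ _ w _ hm =>
    obtain ⟨q', i', s'⟩ := d
    obtain ⟨-, a, Z, u, t, hi : c.input = _, hs, rfl : s' = _, hδ⟩ := hm
    obtain ⟨rfl, rfl⟩ := List.cons.inj hs
    replace hδ : SimMove P (.answer b) a _ (q', u, w) := hδ
    cases hδ with
    | giveUp => exact .inl (.reject _ rfl)
    | resume _ hask' =>
      obtain rfl := Option.some.inj (hask.symm.trans hask')
      obtain rfl : c.input = i' := hi
      exact .inr (by simp [simCfg])

theorem not_step_of_halted {C D : P.toOracleNPDA.OCfg}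
    (hC : C.cfg.state ∈ P.toOracleNPDA.toPDA.halt) : ¬ P.toOracleNPDA.Step A C D := by
  rintro (⟨_, _, _, _, _, _, hm⟩ | ⟨_, _, _, hq, _⟩ | ⟨_, _, _, hq, _⟩)
  · exact hm.1 hC
  all_goals exact P.toOracleNPDA.query_not_halt (hq ▸ hC)

theorem Simulates.step {C D : P.toOracleNPDA.OCfg} {c : P.Cfg} {m : ℕ} (hC : Simulates A C c m)
    (h : P.toOracleNPDA.Step A C D) :
    (∃ m' < m, Simulates A D c m') ∨ ∃ d, P.Step A c d ∧ D = P.simCfg d := by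
  cases hC with
  | run => exact step_simCfg h
  | query hacc hask =>
    obtain ⟨b, hb, rfl⟩ := step_queryCfg h
    exact .inl ⟨1, by simp, .answer hacc hask hb⟩
  | answer hacc hask hb =>
    rcases step_answerCfg hask h with h | rfl
    · exact .inl ⟨0, by simp, h⟩
    · exact .inr ⟨_, .ask hacc hask hb, rfl⟩
  | reject _ hC => exact absurd h (not_step_of_halted (.inr hC))

theorem Simulates.halted_or_exists_step {C : P.toOracleNPDA.OCfg} {c : P.Cfg} {m : ℕ}
    (hC : Simulates A C c m) :
    C.cfg.state ∈ P.toOracleNPDA.toPDA.halt ∨ ∃ D, P.toOracleNPDA.Step A C D := by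
  cases hC with
  | run =>
    obtain ⟨Z, t, hs, -⟩ := P.exists_simStack_eq c.stack
    let giveUpCfg : P.toOracleNPDA.toPDA.Cfg := ⟨SimState.reject, c.input, Z :: t⟩
    exact or_iff_not_imp_left.2 fun hhalt => ⟨⟨giveUpCfg, c.query, c.output⟩, .of_move_none
      (fun h => by cases h) ⟨hhalt, none, Z, [Z], t, rfl, hs, rfl, .giveUp _ _⟩⟩
  | query =>
    classical exact .inr ⟨_, step_queryCfg_answerCfg (b := decide (_ ∈ A)) decide_eq_true_iff⟩
  | answer _ hask => exact .inr ⟨_, step_answerCfg_simCfg _ hask⟩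
  | reject _ hC => exact .inl (.inr hC)

theorem Simulates.haltsWithin {C : P.toOracleNPDA.OCfg} {c : P.Cfg} {t m : ℕ}
    (hc : HaltsWithin (P.Step A) (Stuck (P.Step A)) t c) (hC : Simulates A C c m) :
    HaltsWithin (P.toOracleNPDA.Step A) (fun C => C.cfg.state ∈ P.toOracleNPDA.toPDA.halt)
      (4 * t + m) C := by
  induction t using Nat.strong_induction_on generalizing C c m with
  | _ t iht =>
  induction m using Nat.strong_induction_on generalizing C with
  | _ m ihm =>
  refine .of_forall_step hC.halted_or_exists_step fun D hD => ?_
  rcases hC.step hD with ⟨m', hm', hD⟩ | ⟨d, hd, rfl⟩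
  · exact ⟨4 * t + m', by omega, ihm m' hm' hD⟩
  · obtain ⟨t', ht', hd⟩ := haltsWithin_stuck_iff.1 hc d hd
    exact ⟨4 * t' + 3, by omega, iht t' ht' hd (.run d)⟩

theorem toOracleNPDA_linearTime (hP : P.LinearTime) : P.toOracleNPDA.LinearTime := by
  obtain ⟨a, b, hab⟩ := hP
  refine ⟨4 * a, 4 * b + 3, fun A x => ?_⟩
  exact ((Simulates.run (P.start x)).haltsWithin (hab A x)).mono (by linarith)

theorem exists_simulates_of_reflTransGen {c : P.Cfg} {C : P.toOracleNPDA.OCfg}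
    (h : Relation.ReflTransGen (P.toOracleNPDA.Step A) (P.simCfg c) C) :
    ∃ d m, Relation.ReflTransGen (P.Step A) c d ∧ Simulates A C d m := by
  induction h with
  | refl => exact ⟨c, 3, .refl, .run c⟩
  | tail _ hstep ih =>
    obtain ⟨d, m, hd, hC⟩ := ih
    rcases hC.step hstep with ⟨m', -, hD⟩ | ⟨e, he, rfl⟩
    · exact ⟨d, m', hd, hD⟩
    · exact ⟨e, 3, hd.tail he, .run e⟩

theorem toOracleNPDA_outputs (P : OracleProgram σ γ β) (A : Language β) (x : List σ) :
    P.toOracleNPDA.outputs A x = P.outputs A x := by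
  refine Set.Subset.antisymm ?_ ?_
  · rintro z ⟨C, ⟨q, hq, hqC⟩, rfl, h⟩
    obtain ⟨c, m, hc, hC⟩ := exists_simulates_of_reflTransGen (c := P.start x) h
    cases hC with
    | run =>
      cases hqC
      exact ⟨c, hq, rfl, hc⟩
    | query | answer => cases hqC
    | reject _ hC => exact absurd (hqC.trans hC) nofun
  · rintro z ⟨c, hc, rfl, h⟩
    exact ⟨P.simCfg c, ⟨_, hc, rfl⟩, rfl, reflTransGen_simCfg h⟩

end OracleProgram

/-! ### Computation paths -/

theorem filterMap_cons_eq_append {α β : Type} (f : α → Option β) (a : α) (l : List α) :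
    (a :: l).filterMap f = (f a).toList ++ l.filterMap f := by
  cases h : f a <;> simp [h]

namespace OracleNPDA

variable {σ γ β : Type}

/-- A transition of an oracle npda, as a letter of the words that encode computation paths. -/
structure Instr (M : OracleNPDA σ γ β) : Type where
  source : M.Q
  read : Option (TapeSymbol σ)
  top : M.Θ
  target : M.Q
  push : List M.Θ
  out : Option γ
  query : Option β
  mem : (target, push, (out, query)) ∈ M.δ source read top

instance [Finite σ] (M : OracleNPDA σ γ β) : Finite M.Instr := by
  have := M.finite_Q
  have := M.finite_Θ
  have (k : M.Q × Option (TapeSymbol σ) × M.Θ) : Finite (M.δ k.1 k.2.1 k.2.2) := M.finite_δ _ _ _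
  let transition (t : M.Instr) : Σ k : M.Q × Option (TapeSymbol σ) × M.Θ, M.δ k.1 k.2.1 k.2.2 :=
    ⟨(t.source, t.read, t.top), ⟨_, t.mem⟩⟩
  refine Finite.of_injective transition fun t t' h => ?_
  obtain ⟨q, a, Z, q', u, o, k, ht⟩ := t
  obtain ⟨_, _, _, _, _, _, _, ht'⟩ := t'
  obtain ⟨⟨⟩, h⟩ := Sigma.mk.inj h
  obtain ⟨⟩ := Subtype.mk.inj (eq_of_heq h)
  rfl

/-- One step of a computation path: a transition or an answer of the oracle. -/
abbrev Label (M : OracleNPDA σ γ β) : Type := M.Instr ⊕ Bool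

variable {M : OracleNPDA σ γ β} {A : Language β}

/-- The tape symbol that a step reads. -/
def labelRead : M.Label → Option (TapeSymbol σ) := Sum.elim Instr.read fun _ => none

/-- The output symbol that a step writes. -/
def labelOut : M.Label → Option γ := Sum.elim Instr.out fun _ => none

/-- The tape symbols read along a path. -/
def reads (p : List M.Label) : List (TapeSymbol σ) := p.filterMap labelRead

/-- The output symbols written along a path. -/
def outs (p : List M.Label) : List γ := p.filterMap labelOut

@[simp] theorem outs_nil : outs ([] : List M.Label) = [] := rfl

@[simp] theorem reads_cons (l : M.Label) (p : List M.Label) :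
    reads (l :: p) = (labelRead l).toList ++ reads p := filterMap_cons_eq_append ..

@[simp] theorem outs_cons (l : M.Label) (p : List M.Label) :
    outs (l :: p) = (labelOut l).toList ++ outs p := filterMap_cons_eq_append ..

/-- The part of a configuration that determines which steps are possible, apart from the input:
a configuration without its input tape and its output tape. -/
structure Core (M : OracleNPDA σ γ β) : Type where
  state : M.Q
  stack : List M.Θ
  query : List β

/-- The initial configuration without its input tape and its output tape. -/
def coreStart (M : OracleNPDA σ γ β) : M.Core := ⟨M.q₀, [M.Z₀], []⟩

/-- A configuration without its input tape and its output tape. -/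
def OCfg.core (C : M.OCfg) : M.Core := ⟨C.cfg.state, C.cfg.stack, C.query⟩

/-- The configuration with given unread input and output. -/
def Core.full (c : M.Core) (i : List (TapeSymbol σ)) (z : List γ) : M.OCfg :=
  ⟨⟨c.state, i, c.stack⟩, c.query, z⟩

/-- The state after the oracle's answer `b`. -/
def answerState (M : OracleNPDA σ γ β) (b : Bool) : M.Q := if b then M.qYes else M.qNo

/-- The transition starts neither in a halting state nor in the query state. -/
def Instr.Enabled (t : M.Instr) : Prop := t.source ∉ M.toPDA.halt ∧ t.source ≠ M.qQuery

/-- The effect of a labelled step. -/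
inductive LStep (M : OracleNPDA σ γ β) (A : Language β) : M.Core → M.Label → M.Core → Prop
  | instr {t : M.Instr} (s : List M.Θ) (y : List β) (ht : t.Enabled) :
      LStep M A ⟨t.source, t.top :: s, y⟩ (.inl t)
        ⟨t.target, t.push ++ s, y ++ t.query.toList⟩
  | answer {b : Bool} {s : List M.Θ} {y : List β} (hb : b = true ↔ y ∈ A) :
      LStep M A ⟨M.qQuery, s, y⟩ (.inr b) ⟨M.answerState b, s, []⟩

/-- `M.Run A c p d`: the path `p` leads from `c` to `d`. -/
inductive Run (M : OracleNPDA σ γ β) (A : Language β) : M.Core → List M.Label → M.Core → Prop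
  | nil (c : M.Core) : Run M A c [] c
  | cons {c d e : M.Core} {l : M.Label} {p : List M.Label} (h : M.LStep A c l d)
      (hp : Run M A d p e) : Run M A c (l :: p) e

/-- The path `p` leads from `c` to an accepting state. -/
def AcceptingRun (M : OracleNPDA σ γ β) (A : Language β) (c : M.Core) (p : List M.Label) : Prop :=
  ∃ d, M.Run A c p d ∧ d.state ∈ M.acc

theorem lStep_inl_iff {c d : M.Core} {t : M.Instr} : M.LStep A c (.inl t) d ↔
    t.Enabled ∧ c.state = t.source ∧ ∃ s, c.stack = t.top :: s ∧
      d = ⟨t.target, t.push ++ s, c.query ++ t.query.toList⟩ := by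
  constructor
  · rintro ⟨s, y, ht⟩
    exact ⟨ht, rfl, s, rfl, rfl⟩
  · obtain ⟨q, _, y⟩ := c
    rintro ⟨ht, rfl : q = _, s, rfl, rfl⟩
    exact .instr s y ht

theorem lStep_inr_iff {c d : M.Core} {b : Bool} : M.LStep A c (.inr b) d ↔
    c.state = M.qQuery ∧ (b = true ↔ c.query ∈ A) ∧ d = ⟨M.answerState b, c.stack, []⟩ := by
  constructor
  · rintro (_ | hb)
    exact ⟨rfl, hb, rfl⟩
  · obtain ⟨q, s, y⟩ := c
    rintro ⟨rfl : q = _, hb, rfl⟩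
    exact .answer hb

theorem LStep.det {c d d' : M.Core} {l : M.Label} (h : M.LStep A c l d)
    (h' : M.LStep A c l d') : d = d' := by
  rcases l with t | b
  · obtain ⟨-, -, s, hs, rfl⟩ := lStep_inl_iff.1 h
    obtain ⟨-, -, s', hs', rfl⟩ := lStep_inl_iff.1 h'
    obtain rfl : s = s' := (List.cons.inj (hs.symm.trans hs')).2
    rfl
  · rw [(lStep_inr_iff.1 h).2.2, (lStep_inr_iff.1 h').2.2]

theorem LStep.exists_and_iff {c d : M.Core} {l : M.Label} (h : M.LStep A c l d)
    {P : M.Core → Prop} : (∃ d', M.LStep A c l d' ∧ P d') ↔ P d :=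
  ⟨fun ⟨_, h', hP⟩ => h.det h' ▸ hP, fun hP => ⟨d, h, hP⟩⟩

theorem LStep.notMem_halt {c d : M.Core} {l : M.Label} (h : M.LStep A c l d) :
    c.state ∉ M.toPDA.halt := by
  cases h with
  | instr _ _ ht => exact ht.1
  | answer => exact M.query_not_halt

theorem LStep.state_ne_qQuery {c d : M.Core} {l : M.Label} (h : M.LStep A c l d)
    {s : TapeSymbol σ} (hs : labelRead l = some s) : c.state ≠ M.qQuery := by
  cases h with
  | instr _ _ ht => exact ht.2
  | answer => cases hs

theorem LStep.step {c d : M.Core} {l : M.Label} (h : M.LStep A c l d)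
    (i : List (TapeSymbol σ)) (z : List γ) :
    M.Step A (c.full ((labelRead l).toList ++ i) z) (d.full i (z ++ (labelOut l).toList)) := by
  cases h with
  | @instr t s y ht =>
    exact .move _ ⟨t.target, i, t.push ++ s⟩ _ _ (t.out, t.query) ht.2
      ⟨ht.1, t.read, t.top, t.push, s, rfl, rfl, rfl, t.mem⟩
  | @answer b s y hb =>
    rw [show labelOut (.inr b : M.Label) = none from rfl, Option.toList_none, List.append_nil]
    cases b with
    | true => exact .yes _ _ _ rfl (hb.1 rfl)
    | false => exact .no _ _ _ rfl (by simpa using hb)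

theorem exists_lStep_of_step {C D : M.OCfg} (h : M.Step A C D) :
    ∃ l, M.LStep A C.core l D.core ∧ C.cfg.input = (labelRead l).toList ++ D.cfg.input ∧
      D.output = C.output ++ (labelOut l).toList := by
  cases h with
  | move c d y z w hq hm =>
    obtain ⟨q, i, s'⟩ := c
    obtain ⟨q', i', s''⟩ := d
    obtain ⟨hhalt, a, Z, u, s, hi, rfl : s' = _, rfl : s'' = _, hδ⟩ := hm
    exact ⟨.inl ⟨q, a, Z, q', u, w.1, w.2, hδ⟩,
      .instr (t := ⟨q, a, Z, q', u, w.1, w.2, hδ⟩) s y ⟨hhalt, hq⟩, hi, rfl⟩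
  | yes c y z hq hy =>
    obtain ⟨_, i, s⟩ := c
    obtain rfl := hq
    exact ⟨.inr true, .answer (by simpa using hy), rfl, (List.append_nil _).symm⟩
  | no c y z hq hy =>
    obtain ⟨_, i, s⟩ := c
    obtain rfl := hq
    exact ⟨.inr false, .answer (by simpa using hy), rfl, (List.append_nil _).symm⟩

theorem Run.of_append {c e : M.Core} {p p' : List M.Label} (h : M.Run A c (p ++ p') e) :
    ∃ d, M.Run A c p d ∧ M.Run A d p' e := by
  induction p generalizing c with
  | nil => exact ⟨c, .nil c, h⟩
  | cons l p ih =>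
    cases h with
    | cons hl hp =>
      obtain ⟨d, hp, hp'⟩ := ih hp
      exact ⟨d, .cons hl hp, hp'⟩

theorem acceptingRun_nil_iff {c : M.Core} : M.AcceptingRun A c [] ↔ c.state ∈ M.acc :=
  ⟨fun ⟨_, .nil _, hc⟩ => hc, fun hc => ⟨c, .nil c, hc⟩⟩

theorem acceptingRun_cons_iff {c : M.Core} {l : M.Label} {p : List M.Label} :
    M.AcceptingRun A c (l :: p) ↔ ∃ d, M.LStep A c l d ∧ M.AcceptingRun A d p :=
  ⟨fun ⟨e, .cons hl hp, he⟩ => ⟨_, hl, e, hp, he⟩, fun ⟨_, hl, e, hp, he⟩ => ⟨e, .cons hl hp, he⟩⟩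

theorem AcceptingRun.eq_nil {c : M.Core} {p : List M.Label} (hp : M.AcceptingRun A c p)
    (hc : c.state ∈ M.acc) : p = [] := by
  obtain _ | ⟨l, p⟩ := p
  · rfl
  · obtain ⟨d, hl, -⟩ := acceptingRun_cons_iff.1 hp
    exact absurd (.inl hc) hl.notMem_halt

theorem Run.reflTransGen {c d : M.Core} {p : List M.Label} (h : M.Run A c p d)
    (i : List (TapeSymbol σ)) (z : List γ) :
    Relation.ReflTransGen (M.Step A) (c.full (reads p ++ i) z) (d.full i (z ++ outs p)) := by
  induction h generalizing z with
  | nil => simpa using .refl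
  | @cons _ _ _ l _ hl _ ih =>
    simpa [List.append_assoc] using (ih (z ++ (labelOut l).toList)).head (hl.step _ z)

theorem exists_run_of_reflTransGen {C D : M.OCfg} (h : Relation.ReflTransGen (M.Step A) C D) :
    ∃ p, M.Run A C.core p D.core ∧ C.cfg.input = reads p ++ D.cfg.input ∧
      D.output = C.output ++ outs p := by
  induction h using Relation.ReflTransGen.head_induction_on with
  | refl => exact ⟨[], .nil _, rfl, (List.append_nil _).symm⟩
  | head h _ ih =>
    obtain ⟨l, hl, hread, hout⟩ := exists_lStep_of_step h
    obtain ⟨p, hp, hreads, houts⟩ := ih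
    exact ⟨l :: p, .cons hl hp, by simp [hread, hreads], by simp [hout, houts]⟩

/-- The paths that lead from `c` to an accepting state and read a part of the tape `v`. -/
def acceptingRuns (M : OracleNPDA σ γ β) (A : Language β) (c : M.Core)
    (v : List (TapeSymbol σ)) : Set (List M.Label) :=
  {p | M.AcceptingRun A c p ∧ reads p <+: v}

theorem mem_outputs_iff {x : List σ} {z : List γ} :
    z ∈ M.outputs A x ↔ ∃ p ∈ M.acceptingRuns A M.coreStart (inputTape x), outs p = z := by
  constructor
  · rintro ⟨C, hC, rfl, h⟩
    obtain ⟨p, hp, hreads, houts⟩ := exists_run_of_reflTransGen h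
    exact ⟨p, ⟨⟨C.core, hp, hC⟩, C.cfg.input, hreads.symm⟩, houts.symm⟩
  · rintro ⟨p, ⟨⟨d, hp, hd⟩, r, hreads⟩, rfl⟩
    refine ⟨d.full r (outs p), hd, rfl, ?_⟩
    have hx : M.coreStart.full (reads p ++ r) [] = M.start x := by rw [hreads]; rfl
    exact hx ▸ hp.reflTransGen r []

theorem not_step_of_mem_halt (C D : M.OCfg) (hC : C.cfg.state ∈ M.toPDA.halt) :
    ¬ M.Step A C D := fun h =>
  let ⟨_, hl, _⟩ := exists_lStep_of_step h
  hl.notMem_halt hC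

/-- All computation paths on inputs of length `n` halt within `a * n + b` steps, no matter what
oracle is used. -/
def HasTimeBound (M : OracleNPDA σ γ β) (a b : ℕ) : Prop :=
  ∀ (A : Language β) (x : List σ),
    HaltsWithin (M.Step A) (fun c => c.cfg.state ∈ M.toPDA.halt) (a * x.length + b) (M.start x)

theorem Run.length_le_of_haltsWithin {c d : M.Core} {p : List M.Label} (h : M.Run A c p d)
    {t : ℕ} {i : List (TapeSymbol σ)} {z : List γ}
    (ht : HaltsWithin (M.Step A) (fun C => C.cfg.state ∈ M.toPDA.halt) t
      (c.full (reads p ++ i) z)) : p.length ≤ t := by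
  induction h generalizing t z with
  | nil => exact t.zero_le
  | cons hl _ ih =>
    rw [reads_cons, List.append_assoc] at ht
    obtain ⟨t', ht', h⟩ := ht.of_step not_step_of_mem_halt (hl.step _ z)
    exact (Nat.succ_le_succ (ih h)).trans ht'

theorem Run.length_le {a b : ℕ} (hM : M.HasTimeBound a b) {p : List M.Label} {d : M.Core}
    (h : M.Run A M.coreStart p d) {x : List σ} (hx : reads p <+: inputTape x) :
    p.length ≤ a * x.length + b := by
  obtain ⟨i, hi⟩ := hx
  have hx : M.coreStart.full (reads p ++ i) [] = M.start x := by rw [hi]; rfl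
  exact h.length_le_of_haltsWithin (hx ▸ hM A x)

end OracleNPDA

/-- What a finite automaton knows after having read a part of an input tape: how it continues, or
that it is not part of an input tape. -/
inductive TapePhase : Type
  | start
  | inside
  | done
  | malformed

namespace TapePhase

variable {σ : Type}

instance : Finite TapePhase :=
  Set.finite_univ_iff.1 <|
    (Set.toFinite {.start, .inside, .done, .malformed}).subset fun f _ => by cases f <;> simp

/-- The transition function of the automaton. -/
def step : TapePhase → TapeSymbol σ → TapePhase
  | start, .leftEnd => inside
  | inside, .letter _ => inside
  | inside, .rightEnd => done
  | _, _ => malformed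

/-- The phase that is reached from `f` by reading the symbols of `v`. -/
def after (f : TapePhase) (v : List (TapeSymbol σ)) : TapePhase := v.foldl step f

theorem after_append (f : TapePhase) (v w : List (TapeSymbol σ)) :
    f.after (v ++ w) = (f.after v).after w := List.foldl_append

theorem malformed_after (v : List (TapeSymbol σ)) : malformed.after v = malformed := by
  induction v with
  | nil => rfl
  | cons _ _ ih => exact ih

theorem done_after_cons (s : TapeSymbol σ) (v : List (TapeSymbol σ)) :
    done.after (s :: v) = malformed := malformed_after v

theorem after_ne_malformed_of_isPrefix {f : TapePhase} {v w : List (TapeSymbol σ)}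
    (hvw : v <+: w) (hw : f.after w ≠ malformed) : f.after v ≠ malformed := by
  obtain ⟨u, rfl⟩ := hvw
  intro hv
  exact hw (by rw [after_append, hv, malformed_after])

theorem start_after_inputTape (x : List σ) : start.after (inputTape x) = done := by
  have inside_after (x : List σ) :
      inside.after (x.map TapeSymbol.letter ++ [.rightEnd]) = done := by
    induction x with
    | nil => rfl
    | cons _ _ ih => exact ih
  exact inside_after x

theorem eq_inputTape_of_after_eq_done {v : List (TapeSymbol σ)} {x : List σ}
    (hx : v <+: inputTape x) (hv : start.after v = done) : v = inputTape x := by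
  obtain ⟨w, hw⟩ := hx
  obtain _ | ⟨s, w⟩ := w
  · simpa using hw
  · have := start_after_inputTape x
    rw [← hw, after_append, hv, done_after_cons] at this
    cases this

theorem exists_isPrefix_of_inside {v : List (TapeSymbol σ)} (hv : inside.after v ≠ malformed) :
    ∃ x : List σ, v <+: x.map TapeSymbol.letter ++ [.rightEnd] ∧ x.length ≤ v.length := by
  induction v with
  | nil => exact ⟨[], List.nil_prefix, le_rfl⟩
  | cons s v ih =>
    cases s with
    | leftEnd => exact absurd (malformed_after v) hv
    | rightEnd =>
      obtain _ | ⟨_, v⟩ := v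
      · exact ⟨[], List.prefix_rfl, Nat.zero_le _⟩
      · exact absurd (malformed_after v) hv
    | letter a =>
      obtain ⟨x, hx, hlen⟩ := ih hv
      exact ⟨a :: x, List.cons_prefix_cons.2 ⟨rfl, hx⟩, Nat.succ_le_succ hlen⟩

theorem exists_isPrefix_inputTape {v : List (TapeSymbol σ)} (hv : start.after v ≠ malformed) :
    ∃ x : List σ, v <+: inputTape x ∧ x.length ≤ v.length := by
  obtain _ | ⟨s, v⟩ := v
  · exact ⟨[], List.nil_prefix, le_rfl⟩
  cases s with
  | leftEnd =>
    obtain ⟨x, hx, hlen⟩ := exists_isPrefix_of_inside hv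
    exact ⟨x, List.cons_prefix_cons.2 ⟨rfl, hx⟩, hlen.trans (Nat.le_succ _)⟩
  | rightEnd | letter => exact absurd (malformed_after v) hv

end TapePhase

/-! ### Encoded paths -/

-- `List.cons_le_cons_iff` concerns another `LE` instance than that of the linear order on lists.
theorem cons_le_cons_iff_of_linearOrder {α : Type} [LinearOrder α] {a b : α} {l m : List α} :
    a :: l ≤ b :: m ↔ a < b ∨ a = b ∧ l ≤ m := by
  rw [le_iff_lt_or_eq, le_iff_lt_or_eq, List.cons_lt_cons_iff, List.cons.injEq]
  tauto

namespace OracleNPDA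

variable {σ γ β : Type}

section EncodedPath

/-- A letter of the words that encode paths together with the tape symbols they leave unread. -/
abbrev PathSymbol (M : OracleNPDA σ γ β) : Type := M.Label ⊕ TapeSymbol σ

variable {M : OracleNPDA σ γ β} {A : Language β}

/-- The tape symbol that a letter of an encoded path accounts for. -/
def symRead : M.PathSymbol → Option (TapeSymbol σ) := Sum.elim labelRead some

/-- The output symbol that a letter of an encoded path accounts for. -/
def symOut : M.PathSymbol → Option γ := Sum.elim labelOut fun _ => none

/-- The content of the input tape according to an encoded path. -/
def symReads (z : List M.PathSymbol) : List (TapeSymbol σ) := z.filterMap symRead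

/-- The output symbols written along an encoded path. -/
def symOuts (z : List M.PathSymbol) : List γ := z.filterMap symOut

@[simp] theorem symReads_cons (x : M.PathSymbol) (z : List M.PathSymbol) :
    symReads (x :: z) = (symRead x).toList ++ symReads z := filterMap_cons_eq_append ..

/-- The word that encodes the path `p`, which leaves `r` unread. -/
def encode (p : List M.Label) (r : List (TapeSymbol σ)) : List M.PathSymbol :=
  p.map .inl ++ r.map .inr

theorem symReads_encode (p : List M.Label) (r : List (TapeSymbol σ)) :
    symReads (encode p r) = reads p ++ r := by
  have hr : r.filterMap ((symRead : M.PathSymbol → _) ∘ .inr) = r := List.filterMap_some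
  have hp : p.filterMap ((symRead : M.PathSymbol → _) ∘ .inl) = reads p := rfl
  rw [symReads, encode, List.filterMap_append, List.filterMap_map, List.filterMap_map, hr, hp]

theorem symOuts_encode (p : List M.Label) (r : List (TapeSymbol σ)) :
    symOuts (encode p r) = outs p := by
  have hr : r.filterMap ((symOut : M.PathSymbol → _) ∘ .inr) = [] :=
    List.filterMap_eq_nil_iff.2 fun _ _ => rfl
  have hp : p.filterMap ((symOut : M.PathSymbol → _) ∘ .inl) = outs p := rfl
  rw [symOuts, encode, List.filterMap_append, List.filterMap_map, List.filterMap_map, hr, hp,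
    List.append_nil]

theorem symOuts_mem_outputs {x : List σ} {p : List M.Label} {r : List (TapeSymbol σ)}
    (hp : M.AcceptingRun A M.coreStart p) (hx : symReads (encode p r) = inputTape x) :
    symOuts (encode p r) ∈ M.outputs A x := by
  rw [symReads_encode] at hx
  exact mem_outputs_iff.2 ⟨p, ⟨hp, r, hx⟩, (symOuts_encode p r).symm⟩

theorem finite_acceptingRuns [Finite σ] {a b : ℕ} (hM : M.HasTimeBound a b) (x : List σ) :
    (M.acceptingRuns A M.coreStart (inputTape x)).Finite :=
  (List.finite_length_le M.Label (a * x.length + b)).subset fun _ ⟨⟨_, hp, _⟩, hx⟩ =>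
    hp.length_le hM hx

theorem exists_encode_eq_of_isPrefix {z : List M.PathSymbol} {p : List M.Label}
    {r : List (TapeSymbol σ)} (hz : z <+: encode p r) :
    ∃ p₁ r₁, p₁ <+: p ∧ z = encode p₁ r₁ := by
  obtain ⟨w, hw⟩ := hz
  rcases List.append_eq_append_iff.1 hw with ⟨_, hp, -⟩ | ⟨_, rfl, hr⟩
  · obtain ⟨p₁, p₂, rfl, rfl, -⟩ := List.map_eq_append_iff.1 hp
    exact ⟨p₁, [], List.prefix_append p₁ p₂, (List.append_nil _).symm⟩
  · obtain ⟨r₁, _, -, rfl, -⟩ := List.map_eq_append_iff.1 hr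
    exact ⟨p, r₁, List.prefix_rfl, rfl⟩

theorem length_lt_of_isPrefix_encode {a b : ℕ} (hM : M.HasTimeBound a b) {x : List σ}
    {p : List M.Label} (hp : M.AcceptingRun A M.coreStart p) {r : List (TapeSymbol σ)}
    (hx : symReads (encode p r) = inputTape x) {z : List M.PathSymbol} (hz : z <+: encode p r) :
    z.length < (b + 1) + (a + 1) * (symReads z).length := by
  obtain ⟨p₁, r₁, ⟨p₂, rfl⟩, rfl⟩ := exists_encode_eq_of_isPrefix hz
  obtain ⟨_, hp, -⟩ := hp
  obtain ⟨_, hp₁, -⟩ := hp.of_append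
  have hreads : reads p₁ <+: inputTape x := by
    rw [symReads_encode, reads, List.filterMap_append, List.append_assoc] at hx
    exact ⟨_, hx⟩
  obtain ⟨x', hx', hlen⟩ := TapePhase.exists_isPrefix_inputTape <|
    TapePhase.after_ne_malformed_of_isPrefix hreads (by rw [TapePhase.start_after_inputTape]; nofun)
  have htime := hp₁.length_le hM hx'
  rw [symReads_encode, encode, List.length_append, List.length_append, List.length_map,
    List.length_map]
  nlinarith

theorem LStep.cons_mem_acceptingRuns_iff {c d : M.Core} {l : M.Label} (hl : M.LStep A c l d)
    {p : List M.Label} {z : List M.PathSymbol} :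
    l :: p ∈ M.acceptingRuns A c (symReads (.inl l :: z)) ↔
      p ∈ M.acceptingRuns A d (symReads z) := by
  have hrun : M.AcceptingRun A c (l :: p) ↔ M.AcceptingRun A d p :=
    acceptingRun_cons_iff.trans hl.exists_and_iff
  have hreads : reads (l :: p) <+: symReads (.inl l :: z) ↔ reads p <+: symReads z := by
    rw [reads_cons, symReads_cons]
    exact List.prefix_append_right_inj _
  exact and_congr hrun hreads

section Order

variable [LinearOrder M.Label]

/-- `z` encodes a path that leads from `c` to an accepting state, and this path is the
lexicographically least one for the same content of the input tape. -/
def EncodesLeast (M : OracleNPDA σ γ β) [LinearOrder M.Label] (A : Language β) (c : M.Core)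
    (z : List M.PathSymbol) : Prop :=
  ∃ p r, z = encode p r ∧ IsLeast (M.acceptingRuns A c (symReads z)) p

/-- Some path that leads from `c` to an accepting state for the tape content `v` starts with a
smaller step than `l`. -/
def HasRival (M : OracleNPDA σ γ β) [LinearOrder M.Label] (A : Language β) (c : M.Core)
    (l : M.Label) (v : List (TapeSymbol σ)) : Prop :=
  ∃ p ∈ M.acceptingRuns A c v, ∀ l' ∈ p.head?, l' < l

theorem EncodesLeast.eq {c : M.Core} {z z' : List M.PathSymbol} (hz : M.EncodesLeast A c z)
    (hz' : M.EncodesLeast A c z') (h : symReads z = symReads z') : z = z' := by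
  obtain ⟨p, r, rfl, hp⟩ := hz
  obtain ⟨p', r', rfl, hp'⟩ := hz'
  rw [← h] at hp'
  obtain rfl := hp.unique hp'
  simp only [symReads_encode, List.append_cancel_left_eq] at h
  rw [h]

theorem exists_encodesLeast [Finite σ] {a b : ℕ} (hM : M.HasTimeBound a b) {x : List σ}
    (h : (M.outputs A x).Nonempty) :
    ∃ z, symReads z = inputTape x ∧ M.EncodesLeast A M.coreStart z := by
  obtain ⟨_, hz⟩ := h
  obtain ⟨p₀, hp₀, -⟩ := mem_outputs_iff.1 hz
  obtain ⟨p, hp, hmin⟩ := Set.exists_min_image _ id (finite_acceptingRuns hM x) ⟨p₀, hp₀⟩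
  obtain ⟨r, hr⟩ := hp.2
  have hz : symReads (encode p r) = inputTape x := by rw [symReads_encode, hr]
  exact ⟨encode p r, hz, p, r, rfl, by rw [hz]; exact ⟨hp, hmin⟩⟩

theorem encodesLeast_nil_iff {c : M.Core} : M.EncodesLeast A c [] ↔ c.state ∈ M.acc := by
  constructor
  · rintro ⟨p, r, hz, hp, -⟩
    obtain rfl : p = [] := by simpa using (List.append_eq_nil_iff.1 hz.symm).1
    exact acceptingRun_nil_iff.1 hp.1
  · intro hc
    exact ⟨[], [], rfl, ⟨acceptingRun_nil_iff.2 hc, List.nil_prefix⟩,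
      fun p _ => not_lt.1 (List.not_lt_nil p)⟩

theorem encodesLeast_inr_cons_iff {c : M.Core} {s : TapeSymbol σ} {z : List M.PathSymbol} :
    M.EncodesLeast A c (.inr s :: z) ↔ c.state ∈ M.acc ∧ M.EncodesLeast A c z := by
  constructor
  · rintro ⟨_ | ⟨l, p⟩, r, hz, hp, -⟩
    · obtain _ | ⟨s, r⟩ := r
      · cases hz
      · cases hz
        exact ⟨acceptingRun_nil_iff.1 hp.1, [], r, rfl, ⟨hp.1, List.nil_prefix⟩,
          fun p _ => not_lt.1 (List.not_lt_nil p)⟩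
    · cases hz
  · rintro ⟨hc, p, r, rfl, hp, -⟩
    obtain rfl := hp.1.eq_nil hc
    exact ⟨[], s :: r, rfl, ⟨hp.1, List.nil_prefix⟩, fun p _ => not_lt.1 (List.not_lt_nil p)⟩

theorem encodesLeast_inl_cons_iff {c : M.Core} {l : M.Label} {z : List M.PathSymbol} :
    M.EncodesLeast A c (.inl l :: z) ↔ (∃ d, M.LStep A c l d ∧ M.EncodesLeast A d z) ∧
      ¬ M.HasRival A c l (symReads (.inl l :: z)) := by
  constructor
  · rintro ⟨_ | ⟨l', p⟩, r, hz, hp, hmin⟩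
    · obtain _ | ⟨s, r⟩ := r <;> cases hz
    obtain ⟨rfl, rfl⟩ : l = l' ∧ z = encode p r := by
      obtain ⟨hl, hz⟩ := List.cons.inj hz
      exact ⟨Sum.inl.inj hl, hz⟩
    obtain ⟨d, hl, -⟩ := acceptingRun_cons_iff.1 hp.1
    have hp' := hl.cons_mem_acceptingRuns_iff.1 hp
    refine ⟨⟨d, hl, p, r, rfl, hp', fun p' hp' => ?_⟩, ?_⟩
    · have := cons_le_cons_iff_of_linearOrder.1 (hmin (hl.cons_mem_acceptingRuns_iff.2 hp'))
      simpa using this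
    · rintro ⟨_ | ⟨l', p'⟩, hp', hlt⟩
      · exact hl.notMem_halt (.inl (acceptingRun_nil_iff.1 hp'.1))
      · exact (hmin hp').not_gt (List.cons_lt_cons_iff.2 (.inl (hlt l' rfl)))
  · rintro ⟨⟨d, hl, p, r, rfl, hp, hmin⟩, hrival⟩
    refine ⟨l :: p, r, rfl, hl.cons_mem_acceptingRuns_iff.2 hp, ?_⟩
    rintro (_ | ⟨l', p'⟩) hp'
    · exact absurd (.inl (acceptingRun_nil_iff.1 hp'.1)) hl.notMem_halt
    refine cons_le_cons_iff_of_linearOrder.2 ?_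
    obtain hlt | rfl | hgt := lt_trichotomy l l'
    · exact .inl hlt
    · exact .inr ⟨rfl, hmin (hl.cons_mem_acceptingRuns_iff.1 hp')⟩
    · exact absurd ⟨_, hp', by simpa using hgt⟩ hrival

end Order

end EncodedPath

/-! ### The checker -/

section Checker

/-- States of the machine that accepts the words which do not encode least paths. It follows the
encoded path (`verify`, `compare` during a query) until it sees an error or deviates from it. -/
inductive CheckerState (M : OracleNPDA σ γ β) : Type
  | init
  | verify (q : M.Q) (f : TapePhase)
  | compare (f : TapePhase) (b : Bool)
  /-- follows a rival path that has not yet consumed the symbol in `buf`; its next step has to be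
  smaller than `lim` -/
  | rival (q : M.Q) (f : TapePhase) (buf : Option (TapeSymbol σ)) (lim : Option M.Label)
  | accept
  | reject

instance [Finite σ] (M : OracleNPDA σ γ β) : Finite M.CheckerState :=
  have := M.finite_Q
  Set.finite_univ_iff.1 <|
    (Set.toFinite ({.init, .accept, .reject} ∪ (Set.range fun u : _ × _ => .verify u.1 u.2) ∪
      (Set.range fun u : _ × _ => .compare u.1 u.2) ∪
      Set.range fun u : _ × _ × _ × _ => .rival u.1 u.2.1 u.2.2.1 u.2.2.2)).subset
        fun s _ => by cases s <;> simp

/-- In state `q` with top stack symbol `Z`, the step `l` is possible for a suitable oracle. -/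
def Applicable (M : OracleNPDA σ γ β) (q : M.Q) (Z : Option M.Θ) : M.Label → Prop
  | .inl t => t.Enabled ∧ q = t.source ∧ Z = some t.top
  | .inr _ => q = M.qQuery

theorem LStep.applicable {M : OracleNPDA σ γ β} {A : Language β} {c d : M.Core} {l : M.Label}
    (h : M.LStep A c l d) : M.Applicable c.state c.stack.head? l := by
  cases h with
  | instr _ _ ht => exact ⟨ht, rfl, rfl⟩
  | answer => rfl

/-- The transitions of the checker. Once it deviates, the inscription it has read may not be
`malformed`: so the rival path reads a prefix of an input tape of `M`, and the time bound of `M`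
applies to it. -/
inductive CheckerMove (M : OracleNPDA σ γ β) [LinearOrder M.Label] :
    M.CheckerState → Option (TapeSymbol M.PathSymbol) → Option M.Θ →
      M.CheckerState × List M.Θ × (Option Empty × Option β) → Prop
  | init : CheckerMove M .init (some .leftEnd) none (.verify M.q₀ .start, [M.Z₀], (none, none))
  | follow {f : TapePhase} {t : M.Instr} (ht : t.Enabled) :
      CheckerMove M (.verify t.source f) (some (.letter (.inl (.inl t)))) (some t.top)
        (.verify t.target (f.after t.read.toList), t.push, (none, t.query))
  | compare {f : TapePhase} {Z : Option M.Θ} {b : Bool} :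
      CheckerMove M (.verify M.qQuery f) (some (.letter (.inl (.inr b)))) Z
        (.compare f b, Z.toList, (none, none))
  | wrong {q : M.Q} {f : TapePhase} {Z : Option M.Θ} {l : M.Label} (h : ¬ M.Applicable q Z l) :
      CheckerMove M (.verify q f) (some (.letter (.inl l))) Z (.accept, Z.toList, (none, none))
  | skip {q : M.Q} {f : TapePhase} {Z : Option M.Θ} {s : TapeSymbol σ} (hq : q ∈ M.acc) :
      CheckerMove M (.verify q f) (some (.letter (.inr s))) Z
        (.verify q (f.step s), Z.toList, (none, none))
  | early {q : M.Q} {f : TapePhase} {Z : Option M.Θ} {s : TapeSymbol σ} (hq : q ∉ M.acc) :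
      CheckerMove M (.verify q f) (some (.letter (.inr s))) Z (.accept, Z.toList, (none, none))
  | finish {q : M.Q} {f : TapePhase} {Z : Option M.Θ} (h : ¬ (f = .done ∧ q ∈ M.acc)) :
      CheckerMove M (.verify q f) (some .rightEnd) Z (.accept, Z.toList, (none, none))
  | deviate {q : M.Q} {f : TapePhase} {Z : Option M.Θ} {l : M.Label}
      (hf : f.after (labelRead l).toList ≠ .malformed) :
      CheckerMove M (.verify q f) (some (.letter (.inl l))) Z
        (.rival q (f.after (labelRead l).toList) (labelRead l) (some l), Z.toList, (none, none))
  | load {q : M.Q} {f : TapePhase} {Z : Option M.Θ} {x : M.PathSymbol} {lim : Option M.Label}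
      (hf : f.after (symRead x).toList ≠ .malformed) :
      CheckerMove M (.rival q f none lim) (some (.letter x)) Z
        (.rival q (f.after (symRead x).toList) (symRead x) lim, Z.toList, (none, none))
  | exec {f : TapePhase} {t : M.Instr} {buf buf' : Option (TapeSymbol σ)} {lim : Option M.Label}
      (ht : t.Enabled) (hbuf : buf.toList = t.read.toList ++ buf'.toList)
      (hlim : ∀ l ∈ lim, .inl t < l) :
      CheckerMove M (.rival t.source f buf lim) none (some t.top)
        (.rival t.target f buf' none, t.push, (none, t.query))
  | success {q : M.Q} {f : TapePhase} {buf : Option (TapeSymbol σ)} {lim : Option M.Label}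
      {Z : Option M.Θ} (hq : q ∈ M.acc) :
      CheckerMove M (.rival q f buf lim) none Z (.accept, Z.toList, (none, none))

theorem finite_checkerMove [Finite σ] (M : OracleNPDA σ γ β) [LinearOrder M.Label]
    (s : M.CheckerState) (a : Option (TapeSymbol M.PathSymbol)) (Z : Option M.Θ) :
    {v | M.CheckerMove s a Z v}.Finite := by
  let silent (s : M.CheckerState) :
    M.CheckerState × List M.Θ × (Option Empty × Option β) := (s, Z.toList, (none, none))
  let followed (k : TapePhase × M.Instr) :
      M.CheckerState × List M.Θ × (Option Empty × Option β) :=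
    (.verify k.2.target (k.1.after k.2.read.toList), k.2.push, (none, k.2.query))
  let executed (k : TapePhase × Option (TapeSymbol σ) × M.Instr) :
      M.CheckerState × List M.Θ × (Option Empty × Option β) :=
    (.rival k.2.2.target k.1 k.2.1 none, k.2.2.push, (none, k.2.2.query))
  refine ((Set.finite_range silent).union <| (Set.finite_range followed).union <|
    (Set.finite_range executed).union <|
      Set.finite_singleton (.verify M.q₀ .start, [M.Z₀], (none, none))).subset ?_
  rintro v (_ | _ | _ | _ | _ | _ | _ | _ | _ | _ | _)
  case init => exact .inr (.inr (.inr rfl))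
  case follow f t _ => exact .inr (.inl ⟨(f, t), rfl⟩)
  case exec f t _ buf' _ _ _ _ => exact .inr (.inr (.inl ⟨(f, buf', t), rfl⟩))
  all_goals exact .inl ⟨_, rfl⟩

open Classical in
/-- The query states of the checker. -/
noncomputable def checkerAsk (M : OracleNPDA σ γ β) [LinearOrder M.Label] :
    M.CheckerState → Option (Bool → M.CheckerState)
  | .compare f b => some fun b' => if b' = b then .verify (M.answerState b) f else .accept
  | .rival q f buf lim =>
    if q = M.qQuery then
      some fun b => if ∀ l ∈ lim, .inr b < l then .rival (M.answerState b) f buf none else .reject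
    else none
  | _ => none

/-- The program that accepts, among the words `z` for which `symReads z` is a part of an input
tape, those which do not encode the least accepting path on some input. -/
noncomputable def checker [Finite σ] (M : OracleNPDA σ γ β) [LinearOrder M.Label] :
    OracleProgram M.PathSymbol Empty β where
  Q := M.CheckerState
  Θ := M.Θ
  finite_Q := inferInstance
  finite_Θ := M.finite_Θ
  δ s a Z := {v | M.CheckerMove s a Z v}
  finite_δ := M.finite_checkerMove
  q₀ := .init
  acc := {.accept}
  ask := M.checkerAsk

variable [Finite σ] {M : OracleNPDA σ γ β} [LinearOrder M.Label] {A : Language β}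

/-- The configuration of the checker in which it follows the encoded path in `c`, with `z` left to
be read. -/
noncomputable def verifyCfg (c : M.Core) (f : TapePhase) (z : List M.PathSymbol) : M.checker.Cfg :=
  ⟨.verify c.state f, z.map .letter ++ [.rightEnd], c.stack, c.query, []⟩

/-- The configuration of the checker in which it waits for the oracle to confirm the answer `b`. -/
def compareCfg (c : M.Core) (f : TapePhase) (b : Bool) (z : List M.PathSymbol) : M.checker.Cfg :=
  ⟨.compare f b, z.map .letter ++ [.rightEnd], c.stack, c.query, []⟩

/-- The configuration of the checker in which it follows a rival path in `c`. -/
def rivalCfg (c : M.Core) (f : TapePhase) (buf : Option (TapeSymbol σ)) (lim : Option M.Label)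
    (z : List M.PathSymbol) : M.checker.Cfg :=
  ⟨.rival c.state f buf lim, z.map .letter ++ [.rightEnd], c.stack, c.query, []⟩

theorem acceptsFrom_of_step {C D : M.checker.Cfg} (h : M.checker.Step A C D)
    (hD : D.state = .accept) : M.checker.AcceptsFrom A C := ⟨D, hD, .single h⟩

theorem step_rivalCfg {c : M.Core} {f : TapePhase} {buf : Option (TapeSymbol σ)}
    {lim : Option M.Label} {z : List M.PathSymbol} {D : M.checker.Cfg}
    (h : M.checker.Step A (rivalCfg c f buf lim z) D) :
    (c.state ∈ M.acc ∧ D.state = .accept) ∨ D.state = .reject ∨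
    (∃ l d buf', M.LStep A c l d ∧ buf.toList = (labelRead l).toList ++ buf'.toList ∧
      (∀ m ∈ lim, l < m) ∧ D = rivalCfg d f buf' none z) ∨
    (buf = none ∧ ∃ x z', z = x :: z' ∧ f.after (symRead x).toList ≠ .malformed ∧
      D = rivalCfg c (f.after (symRead x).toList) (symRead x) lim z') := by
  obtain ⟨q, s, y⟩ := c
  by_cases hq : q = M.qQuery
  · obtain ⟨b, hb, rfl⟩ := h.exists_answer (if_pos hq)
    by_cases hlim : ∀ m ∈ lim, .inr b < m
    · refine .inr (.inr (.inl ⟨.inr b, _, buf, lStep_inr_iff.2 ⟨hq, hb, rfl⟩, rfl, hlim, ?_⟩))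
      simp only [if_pos hlim]
      rfl
    · exact .inr (.inl (if_neg hlim))
  · obtain ⟨a, i, hi, v, hv, rfl⟩ := h.exists_move (if_neg hq)
    change M.CheckerMove (.rival q f buf lim) a s.head? v at hv
    generalize hZ : s.head? = Z at hv
    cases hv with
    | success hq => exact .inl ⟨hq, rfl⟩
    | @exec _ t _ buf' _ ht hbuf hlim =>
      obtain ⟨s, rfl⟩ := List.head?_eq_some_iff.1 hZ
      cases hi
      exact .inr (.inr (.inl ⟨.inl t, _, buf', .instr s y ht, hbuf, hlim, rfl⟩))
    | @load _ _ _ x _ hf =>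
      subst hZ
      obtain _ | ⟨_, z⟩ := z <;> cases hi
      exact .inr (.inr (.inr ⟨rfl, x, z, rfl, hf, OracleProgram.cfg_replace_head? _ _
        (rivalCfg ⟨q, s, y⟩ f none lim (x :: z))⟩))

theorem step_rivalCfg_of_lStep {c d : M.Core} {l : M.Label} (hl : M.LStep A c l d)
    {f : TapePhase} {buf buf' : Option (TapeSymbol σ)} {lim : Option M.Label}
    (hbuf : buf.toList = (labelRead l).toList ++ buf'.toList) (hlim : ∀ m ∈ lim, l < m)
    (z : List M.PathSymbol) :
    M.checker.Step A (rivalCfg c f buf lim z) (rivalCfg d f buf' none z) := by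
  cases hl with
  | @instr t s y ht =>
    exact .move (P := M.checker) (q := .rival t.source f buf lim) (a := none) (s := t.top :: s)
      nofun (if_neg ht.2) (CheckerMove.exec ht hbuf hlim)
  | @answer b s y hb =>
    obtain rfl : buf = buf' := by cases buf <;> cases buf' <;> simp_all [labelRead]
    have := OracleProgram.Step.ask (P := M.checker) (q := .rival M.qQuery f buf lim)
      (i := z.map .letter ++ [.rightEnd]) (s := s) (z := []) nofun (if_pos rfl) hb
    rwa [if_pos hlim] at this

theorem step_rivalCfg_load {f : TapePhase} {x : M.PathSymbol}
    (hf : f.after (symRead x).toList ≠ .malformed) {c : M.Core} (hc : c.state ≠ M.qQuery)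
    (lim : Option M.Label) (z : List M.PathSymbol) :
    M.checker.Step A (rivalCfg c f none lim (x :: z))
      (rivalCfg c (f.after (symRead x).toList) (symRead x) lim z) :=
  .of_silent (c := rivalCfg c f none lim (x :: z)) (a := some (.letter x)) nofun (if_neg hc) rfl
    (CheckerMove.load hf)

theorem acceptsFrom_rivalCfg_of_mem_acc {c : M.Core} (hc : c.state ∈ M.acc) (f : TapePhase)
    (buf : Option (TapeSymbol σ)) (lim : Option M.Label) (z : List M.PathSymbol) :
    M.checker.AcceptsFrom A (rivalCfg c f buf lim z) :=
  acceptsFrom_of_step (.of_silent (c := rivalCfg c f buf lim z) (q := CheckerState.accept)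
    (a := none) nofun (if_neg fun h : c.state = M.qQuery => M.query_not_halt (.inl (h ▸ hc))) rfl
    (CheckerMove.success hc)) rfl

theorem step_compareCfg {c : M.Core} (hc : c.state = M.qQuery) {f : TapePhase} {b : Bool}
    {z : List M.PathSymbol} {D : M.checker.Cfg} (h : M.checker.Step A (compareCfg c f b z) D) :
    (∃ d, M.LStep A c (.inr b) d ∧ D = verifyCfg d f z) ∨
      (¬ (∃ d, M.LStep A c (.inr b) d) ∧ D.state = .accept) := by
  obtain ⟨b', hb', rfl⟩ := h.exists_answer rfl
  by_cases hb : b' = b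
  · refine .inl ⟨_, lStep_inr_iff.2 ⟨hc, hb ▸ hb', rfl⟩, ?_⟩
    simp only [if_pos hb]
    rfl
  · refine .inr ⟨fun ⟨d, hd⟩ => hb ?_, if_neg hb⟩
    exact Bool.eq_iff_iff.2 (hb'.trans (lStep_inr_iff.1 hd).2.1.symm)

theorem step_verifyCfg_nil {c : M.Core} {f : TapePhase} {D : M.checker.Cfg}
    (h : M.checker.Step A (verifyCfg c f []) D) :
    ¬ (f = .done ∧ c.state ∈ M.acc) ∧ D.state = .accept := by
  obtain ⟨q, s, y⟩ := c
  obtain ⟨a, i, hi, v, hv, rfl⟩ := h.exists_move rfl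
  change M.CheckerMove (.verify q f) a s.head? v at hv
  generalize s.head? = Z at hv
  cases hv
  case finish hq => exact ⟨hq, rfl⟩
  all_goals cases hi

theorem step_verifyCfg_inr {c : M.Core} {f : TapePhase} {s : TapeSymbol σ}
    {z : List M.PathSymbol} {D : M.checker.Cfg}
    (h : M.checker.Step A (verifyCfg c f (.inr s :: z)) D) :
    (c.state ∈ M.acc ∧ D = verifyCfg c (f.step s) z) ∨ (c.state ∉ M.acc ∧ D.state = .accept) := by
  obtain ⟨q, s, y⟩ := c
  obtain ⟨a, i, hi, v, hv, rfl⟩ := h.exists_move rfl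
  change M.CheckerMove (.verify q f) a s.head? v at hv
  generalize hZ : s.head? = Z at hv
  cases hv
  case skip hq =>
    cases hi
    subst hZ
    exact .inl ⟨hq, OracleProgram.cfg_replace_head? _ _ (verifyCfg ⟨q, s, y⟩ f _)⟩
  case early hq => exact .inr ⟨hq, rfl⟩
  all_goals cases hi

theorem step_verifyCfg_inl {c : M.Core} {f : TapePhase} {l : M.Label}
    {z : List M.PathSymbol} {D : M.checker.Cfg}
    (h : M.checker.Step A (verifyCfg c f (.inl l :: z)) D) :
    (∃ d, M.LStep A c l d ∧ D = verifyCfg d (f.after (labelRead l).toList) z) ∨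
    (c.state = M.qQuery ∧ ∃ b, l = .inr b ∧ D = compareCfg c f b z) ∨
    (¬ (∃ d, M.LStep A c l d) ∧ D.state = .accept) ∨
    (f.after (labelRead l).toList ≠ .malformed ∧
      D = rivalCfg c (f.after (labelRead l).toList) (labelRead l) (some l) z) := by
  obtain ⟨q, s, y⟩ := c
  obtain ⟨a, i, hi, v, hv, rfl⟩ := h.exists_move rfl
  change M.CheckerMove (.verify q f) a s.head? v at hv
  generalize hZ : s.head? = Z at hv
  cases hv
  case follow t ht =>
    cases hi
    obtain ⟨s, rfl⟩ := List.head?_eq_some_iff.1 hZ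
    exact .inl ⟨_, .instr s y ht, rfl⟩
  case compare b =>
    cases hi
    subst hZ
    exact .inr (.inl ⟨rfl, b, rfl,
      OracleProgram.cfg_replace_head? _ _ (verifyCfg ⟨_, s, y⟩ f _)⟩)
  case wrong h' =>
    cases hi
    subst hZ
    exact .inr (.inr (.inl ⟨fun ⟨d, hl⟩ => h' hl.applicable, rfl⟩))
  case deviate hf =>
    cases hi
    subst hZ
    exact .inr (.inr (.inr ⟨hf, OracleProgram.cfg_replace_head? _ _
      (verifyCfg ⟨q, s, y⟩ f _)⟩))
  all_goals cases hi

theorem step_verifyCfg_compareCfg {c : M.Core} (hc : c.state = M.qQuery) (f : TapePhase) (b : Bool)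
    (z : List M.PathSymbol) :
    M.checker.Step A (verifyCfg c f (.inl (.inr b) :: z)) (compareCfg c f b z) := by
  obtain ⟨_, s, y⟩ := c
  obtain rfl := hc
  exact .of_silent (c := verifyCfg ⟨_, s, y⟩ f _) (a := some (.letter (.inl (.inr b)))) nofun rfl
    rfl CheckerMove.compare

theorem step_compareCfg_verifyCfg {c d : M.Core} {b : Bool} (hl : M.LStep A c (.inr b) d)
    (f : TapePhase) (z : List M.PathSymbol) :
    M.checker.Step A (compareCfg c f b z) (verifyCfg d f z) := by
  obtain ⟨-, hb, rfl⟩ := lStep_inr_iff.1 hl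
  have hask := OracleProgram.Step.ask (P := M.checker) (q := .compare f b)
    (i := z.map .letter ++ [.rightEnd]) (s := c.stack) (z := []) nofun rfl hb
  rwa [if_pos rfl] at hask

theorem acceptsFrom_compareCfg {c : M.Core} {b : Bool} (hb : ¬ (b = true ↔ c.query ∈ A))
    (f : TapePhase) (z : List M.PathSymbol) : M.checker.AcceptsFrom A (compareCfg c f b z) := by
  have hb' : (!b) = true ↔ c.query ∈ A := by cases b <;> simp_all
  exact acceptsFrom_of_step (.ask (P := M.checker) (q := .compare f b) nofun rfl hb')
    (if_neg b.not_ne_self)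

theorem reflTransGen_verifyCfg_of_lStep {c d : M.Core} {l : M.Label} (hl : M.LStep A c l d)
    (f : TapePhase) (z : List M.PathSymbol) :
    Relation.ReflTransGen (M.checker.Step A) (verifyCfg c f (.inl l :: z))
      (verifyCfg d (f.after (labelRead l).toList) z) := by
  rcases l with t | b
  · obtain ⟨s, y, ht⟩ := hl
    exact .single <| .move (P := M.checker) (q := .verify t.source f)
      (a := some (.letter (.inl (.inl t)))) (s := t.top :: s) nofun rfl (CheckerMove.follow ht)
  · exact .tail (.single (step_verifyCfg_compareCfg (lStep_inr_iff.1 hl).1 f b z))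
      (step_compareCfg_verifyCfg hl f z)

theorem acceptsFrom_verifyCfg_of_not_lStep {c : M.Core} {l : M.Label}
    (hl : ¬ ∃ d, M.LStep A c l d) (f : TapePhase) (z : List M.PathSymbol) :
    M.checker.AcceptsFrom A (verifyCfg c f (.inl l :: z)) := by
  by_cases happ : M.Applicable c.state c.stack.head? l
  · rcases l with t | b
    · obtain ⟨s, hs⟩ := List.head?_eq_some_iff.1 happ.2.2
      exact absurd ⟨_, lStep_inl_iff.2 ⟨happ.1, happ.2.1, s, hs, rfl⟩⟩ hl
    · exact (acceptsFrom_compareCfg (fun hb => hl ⟨_, lStep_inr_iff.2 ⟨happ, hb, rfl⟩⟩) f z).head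
        (step_verifyCfg_compareCfg happ f b z)
  · exact acceptsFrom_of_step (.of_silent (c := verifyCfg c f (.inl l :: z))
      (q := CheckerState.accept) (a := some (.letter (.inl l))) nofun rfl rfl
      (CheckerMove.wrong happ)) rfl

theorem acceptsFrom_verifyCfg_nil_iff {c : M.Core} {f : TapePhase} :
    M.checker.AcceptsFrom A (verifyCfg c f []) ↔ ¬ (f = .done ∧ c.state ∈ M.acc) := by
  refine ⟨fun h => ?_, fun h => ?_⟩
  · obtain ⟨D, hD, -⟩ := h.exists_step nofun
    exact (step_verifyCfg_nil hD).1
  · exact acceptsFrom_of_step (.of_silent (c := verifyCfg c f []) (q := CheckerState.accept)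
      (a := some .rightEnd) nofun rfl rfl (CheckerMove.finish h)) rfl

theorem acceptsFrom_verifyCfg_inr_iff {c : M.Core} {f : TapePhase} {s : TapeSymbol σ}
    {z : List M.PathSymbol} : M.checker.AcceptsFrom A (verifyCfg c f (.inr s :: z)) ↔
      (c.state ∈ M.acc → M.checker.AcceptsFrom A (verifyCfg c (f.step s) z)) := by
  refine ⟨fun h hc => ?_, fun h => ?_⟩
  · obtain ⟨D, hD, hacc⟩ := h.exists_step nofun
    rcases step_verifyCfg_inr hD with ⟨-, rfl⟩ | ⟨hc', -⟩
    · exact hacc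
    · exact absurd hc hc'
  · by_cases hc : c.state ∈ M.acc
    · exact (h hc).head (.of_silent (c := verifyCfg c f (.inr s :: z))
        (a := some (.letter (.inr s))) nofun rfl rfl (CheckerMove.skip hc))
    · exact acceptsFrom_of_step (.of_silent (c := verifyCfg c f (.inr s :: z))
        (q := CheckerState.accept) (a := some (.letter (.inr s))) nofun rfl rfl
        (CheckerMove.early hc)) rfl

theorem acceptsFrom_verifyCfg_inl_iff {c : M.Core} {f : TapePhase} {l : M.Label}
    {z : List M.PathSymbol} (hf : f.after (labelRead l).toList ≠ .malformed) :
    M.checker.AcceptsFrom A (verifyCfg c f (.inl l :: z)) ↔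
      (¬ ∃ d, M.LStep A c l d) ∨
      (∃ d, M.LStep A c l d ∧
        M.checker.AcceptsFrom A (verifyCfg d (f.after (labelRead l).toList) z)) ∨
      M.checker.AcceptsFrom A
        (rivalCfg c (f.after (labelRead l).toList) (labelRead l) (some l) z) := by
  constructor
  · intro h
    obtain ⟨D, hD, hacc⟩ := h.exists_step nofun
    rcases step_verifyCfg_inl hD with ⟨d, hl, rfl⟩ | ⟨hc, b, rfl, rfl⟩ | ⟨hl, -⟩ | ⟨-, rfl⟩
    · exact .inr (.inl ⟨d, hl, hacc⟩)
    · obtain ⟨E, hE, hacc⟩ := hacc.exists_step nofun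
      rcases step_compareCfg hc hE with ⟨d, hl, rfl⟩ | ⟨hl, -⟩
      · exact .inr (.inl ⟨d, hl, hacc⟩)
      · exact .inl hl
    · exact .inl hl
    · exact .inr (.inr hacc)
  · rintro (hl | ⟨d, hl, D, hD, h⟩ | h)
    · exact acceptsFrom_verifyCfg_of_not_lStep hl f z
    · exact ⟨D, hD, (reflTransGen_verifyCfg_of_lStep hl f z).trans h⟩
    · exact h.head (.of_silent (c := verifyCfg c f (.inl l :: z)) (a := some (.letter (.inl l)))
        nofun rfl rfl (CheckerMove.deviate hf))

theorem not_step_of_state_eq_reject {C D : M.checker.Cfg} (hC : C.state = .reject) :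
    ¬ M.checker.Step A C D := by
  intro h
  obtain ⟨q, i, s, y, z⟩ := C
  obtain rfl : q = .reject := hC
  obtain ⟨_, _, _, _, hv, _⟩ := h.exists_move rfl
  cases hv

theorem exists_acceptingRun_of_acceptsFrom_rivalCfg {c : M.Core} {f : TapePhase}
    {buf : Option (TapeSymbol σ)} {lim : Option M.Label} {z : List M.PathSymbol}
    (h : M.checker.AcceptsFrom A (rivalCfg c f buf lim z)) :
    ∃ p, M.AcceptingRun A c p ∧ reads p <+: buf.toList ++ symReads z ∧
      ∀ m ∈ lim, ∀ l ∈ p.head?, l < m := by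
  obtain ⟨E, hE, h⟩ := h
  generalize hC : rivalCfg c f buf lim z = C at h
  induction h using Relation.ReflTransGen.head_induction_on generalizing c f buf lim z with
  | refl =>
    subst hC
    cases hE
  | head hstep htail ih =>
    subst hC
    rcases step_rivalCfg hstep with
      ⟨hc, -⟩ | hD | ⟨l, d, buf', hl, hbuf, hlim, rfl⟩ | ⟨rfl, x, z, rfl, -, rfl⟩
    · exact ⟨[], acceptingRun_nil_iff.2 hc, List.nil_prefix, nofun⟩
    · rcases htail.cases_head with rfl | ⟨_, h, -⟩
      · exact absurd (hD.symm.trans hE) nofun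
      · exact absurd h (not_step_of_state_eq_reject hD)
    · obtain ⟨p, hp, hreads, -⟩ := ih rfl
      refine ⟨l :: p, acceptingRun_cons_iff.2 ⟨d, hl, hp⟩, ?_, by simpa using hlim⟩
      rw [reads_cons, hbuf, List.append_assoc]
      exact (List.prefix_append_right_inj _).2 hreads
    · obtain ⟨p, hp, hreads, hlim⟩ := ih rfl
      exact ⟨p, hp, by rwa [symReads_cons], hlim⟩

theorem exists_reflTransGen_rivalCfg_load {c : M.Core} (hc : c.state ≠ M.qQuery) {f : TapePhase}
    (lim : Option M.Label) {z : List M.PathSymbol} {s : TapeSymbol σ} {v : List (TapeSymbol σ)}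
    (hz : symReads z = s :: v) (hs : f.step s ≠ .malformed) :
    ∃ z', symReads z' = v ∧ Relation.ReflTransGen (M.checker.Step A) (rivalCfg c f none lim z)
      (rivalCfg c (f.step s) (some s) lim z') := by
  induction z with
  | nil => cases hz
  | cons x z ih =>
    have hload := step_rivalCfg_load (A := A) (f := f) (x := x) (c := c) (lim := lim) (z := z)
    rw [symReads_cons] at hz
    cases hx : symRead x with
    | none =>
      rw [hx] at hz hload
      obtain ⟨z', hz', h⟩ := ih hz
      have hf : f ≠ .malformed := by
        rintro rfl
        exact hs rfl
      exact ⟨z', hz', h.head (hload hf hc)⟩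
    | some s' =>
      rw [hx] at hz hload
      cases hz
      exact ⟨z, rfl, .single (hload hs hc)⟩

theorem acceptsFrom_rivalCfg_of_acceptingRun {c : M.Core} {p : List M.Label} {f : TapePhase}
    {buf : Option (TapeSymbol σ)} {lim : Option M.Label} {z : List M.PathSymbol}
    (hf : f.after (symReads z) ≠ .malformed) (hp : M.AcceptingRun A c p)
    (hreads : reads p <+: buf.toList ++ symReads z) (hlim : ∀ m ∈ lim, ∀ l ∈ p.head?, l < m) :
    M.checker.AcceptsFrom A (rivalCfg c f buf lim z) := by
  induction p generalizing c f buf lim z with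
  | nil => exact acceptsFrom_rivalCfg_of_mem_acc (acceptingRun_nil_iff.1 hp) f buf lim z
  | cons l p ih =>
    obtain ⟨d, hl, hp⟩ := acceptingRun_cons_iff.1 hp
    replace hlim : ∀ m ∈ lim, l < m := fun m hm => hlim m hm l rfl
    rw [reads_cons] at hreads
    cases hread : labelRead l with
    | none =>
      rw [hread] at hreads
      exact (ih hf hp hreads (by simp)).head
        (step_rivalCfg_of_lStep hl (by rw [hread]; rfl) hlim z)
    | some s =>
      rw [hread, Option.toList_some, List.singleton_append] at hreads
      have hbuffered {f : TapePhase} {z : List M.PathSymbol}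
          (hf : f.after (symReads z) ≠ .malformed) (hreads : reads p <+: symReads z) :
          M.checker.AcceptsFrom A (rivalCfg c f (some s) lim z) :=
        (ih (buf := none) hf hp hreads (by simp)).head
          (step_rivalCfg_of_lStep hl (by rw [hread]; rfl) hlim z)
      cases buf with
      | some s' =>
        obtain ⟨rfl, hrest⟩ := List.cons_prefix_cons.1 hreads
        exact hbuffered hf hrest
      | none =>
        obtain ⟨v, hv : symReads z = s :: v, hz⟩ := List.cons_prefix_iff.1 hreads
        obtain ⟨z', rfl, hload⟩ := exists_reflTransGen_rivalCfg_load (A := A)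
          (hl.state_ne_qQuery hread) lim hv
          (TapePhase.after_ne_malformed_of_isPrefix (v := [s]) ⟨v, hv.symm⟩ hf)
        obtain ⟨E, hE, hacc⟩ := hbuffered (f := f.step s) (by rwa [hv] at hf) hz
        exact ⟨E, hE, hload.trans hacc⟩

theorem acceptsFrom_rivalCfg_some_iff {c : M.Core} {f : TapePhase} {l : M.Label}
    {z : List M.PathSymbol} (hf : f.after (symReads z) ≠ .malformed) :
    M.checker.AcceptsFrom A (rivalCfg c f (labelRead l) (some l) z) ↔
      M.HasRival A c l (symReads (.inl l :: z)) := by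
  rw [symReads_cons]
  constructor
  · intro h
    obtain ⟨p, hp, hreads, hlim⟩ := exists_acceptingRun_of_acceptsFrom_rivalCfg h
    exact ⟨p, ⟨hp, hreads⟩, hlim l rfl⟩
  · rintro ⟨p, ⟨hp, hreads⟩, hlim⟩
    refine acceptsFrom_rivalCfg_of_acceptingRun hf hp hreads ?_
    rintro m ⟨⟩
    exact hlim

theorem acceptsFrom_verifyCfg_iff {c : M.Core} {f : TapePhase} {z : List M.PathSymbol}
    (hf : f.after (symReads z) ≠ .malformed) : M.checker.AcceptsFrom A (verifyCfg c f z) ↔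
      ¬ (f.after (symReads z) = .done ∧ M.EncodesLeast A c z) := by
  induction z generalizing c f with
  | nil => rw [acceptsFrom_verifyCfg_nil_iff, encodesLeast_nil_iff]; rfl
  | cons x z ih =>
    rcases x with l | s
    · have hcons : f.after (symReads (.inl l :: z)) =
          (f.after (labelRead l).toList).after (symReads z) := by
        rw [symReads_cons, TapePhase.after_append]
        rfl
      rw [hcons] at hf ⊢
      have hl : f.after (labelRead l).toList ≠ .malformed := fun h =>
        hf (by rw [h, TapePhase.malformed_after])
      rw [acceptsFrom_verifyCfg_inl_iff hl, acceptsFrom_rivalCfg_some_iff hf,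
        encodesLeast_inl_cons_iff]
      by_cases hstep : ∃ d, M.LStep A c l d
      · obtain ⟨d, hd⟩ := hstep
        rw [hd.exists_and_iff, hd.exists_and_iff, ih hf]
        have : ∃ d, M.LStep A c l d := ⟨d, hd⟩
        tauto
      · exact iff_of_true (.inl hstep) fun ⟨_, ⟨d, hd, _⟩, _⟩ => hstep ⟨d, hd⟩
    · rw [acceptsFrom_verifyCfg_inr_iff, encodesLeast_inr_cons_iff, ih hf]
      change _ ↔ ¬ ((f.step s).after (symReads z) = .done ∧ _)
      tauto

end Checker

/-! ### Running time of the checker -/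

section CheckerTime

/-- At most `n` steps are possible from `c` before the input runs out, given that the machine has
still to read `buf`, followed by a part of `symReads z` that fits to the phase `f` of the tape. -/
def RunBound (M : OracleNPDA σ γ β) (A : Language β) (c : M.Core) (f : TapePhase)
    (buf : Option (TapeSymbol σ)) (z : List M.PathSymbol) (n : ℕ) : Prop :=
  ∀ v, v <+: symReads z → f.after v ≠ .malformed →
    ∀ p d, M.Run A c p d → reads p <+: buf.toList ++ v → p.length ≤ n

section RunBound

variable {M : OracleNPDA σ γ β} {A : Language β} {c d : M.Core} {f : TapePhase}
  {buf buf' : Option (TapeSymbol σ)} {l : M.Label} {x : M.PathSymbol}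
  {z : List M.PathSymbol} {n : ℕ}

theorem RunBound.tail (h : M.RunBound A c f buf z n) (hl : M.LStep A c l d)
    (hbuf : buf.toList = (labelRead l).toList ++ buf'.toList) :
    M.RunBound A d f buf' z (n - 1) := by
  intro v hv hf p e hp hreads
  refine Nat.le_sub_one_of_lt (h v hv hf (l :: p) e (.cons hl hp) ?_)
  rw [reads_cons, hbuf, List.append_assoc]
  exact (List.prefix_append_right_inj _).2 hreads

theorem RunBound.pos (h : M.RunBound A c f buf z n) (hl : M.LStep A c l d)
    (hbuf : buf.toList = (labelRead l).toList ++ buf'.toList) (hf : f ≠ .malformed) : 0 < n := by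
  refine h [] List.nil_prefix hf [l] d (.cons hl (.nil d)) ?_
  rw [reads_cons, hbuf, List.append_assoc]
  exact (List.prefix_append_right_inj _).2 List.nil_prefix

theorem RunBound.load (h : M.RunBound A c f none (x :: z) n) :
    M.RunBound A c (f.after (symRead x).toList) (symRead x) z n := by
  intro v hv hf p e hp hreads
  refine h ((symRead x).toList ++ v) ?_ ?_ p e hp hreads
  · rw [symReads_cons]
    exact (List.prefix_append_right_inj _).2 hv
  · rwa [TapePhase.after_append]

theorem RunBound.of_mem_acc (hc : c.state ∈ M.acc) : M.RunBound A c f buf z n := by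
  rintro v - - p d hp -
  cases hp with
  | nil => exact n.zero_le
  | cons hl => exact absurd (.inl hc) hl.notMem_halt

theorem HasTimeBound.runBound {a b : ℕ} (hM : M.HasTimeBound a b) (A : Language β)
    (z : List M.PathSymbol) : M.RunBound A M.coreStart .start none z (a * z.length + b) := by
  intro v hv hf p d hp hreads
  obtain ⟨x, hx, hlen⟩ := TapePhase.exists_isPrefix_inputTape hf
  have hz : x.length ≤ z.length :=
    hlen.trans (hv.length_le.trans (List.length_filterMap_le ..))
  exact (hp.length_le hM (hreads.trans hx)).trans (by gcongr)

end RunBound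

variable [Finite σ] {M : OracleNPDA σ γ β} [LinearOrder M.Label] {A : Language β}

theorem stuck_of_state_eq_accept {C : M.checker.Cfg} (hC : C.state = .accept) :
    Stuck (M.checker.Step A) C := fun _ h => h.notMem_acc hC

theorem haltsWithin_rivalCfg {c : M.Core} {f : TapePhase} {buf : Option (TapeSymbol σ)}
    {lim : Option M.Label} {z : List M.PathSymbol} {n : ℕ} (hf : f ≠ .malformed)
    (hn : M.RunBound A c f buf z n) :
    HaltsWithin (M.checker.Step A) (Stuck (M.checker.Step A)) (z.length + n + 1)
      (rivalCfg c f buf lim z) := by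
  induction hk : z.length + n using Nat.strong_induction_on generalizing c f buf lim z n with
  | _ k ih =>
  subst hk
  refine haltsWithin_stuck_iff.2 fun D hD => ?_
  rcases step_rivalCfg hD with
    ⟨-, hD⟩ | hD | ⟨l, d, buf', hl, hbuf, -, rfl⟩ | ⟨rfl, x, z, rfl, hf, rfl⟩
  · exact ⟨0, by omega, stuck_of_state_eq_accept hD⟩
  · exact ⟨0, by omega, fun _ => not_step_of_state_eq_reject hD⟩
  · have := hn.pos hl hbuf hf
    exact ⟨_, by omega, ih _ (by omega) hf (hn.tail hl hbuf) rfl⟩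
  · exact ⟨_, by simp, ih _ (by simp) hf hn.load rfl⟩

theorem haltsWithin_compareCfg {c : M.Core} (hc : c.state = M.qQuery) {f : TapePhase} {b : Bool}
    {z : List M.PathSymbol} {t : ℕ}
    (h : ∀ d, M.LStep A c (.inr b) d →
      HaltsWithin (M.checker.Step A) (Stuck (M.checker.Step A)) t (verifyCfg d f z)) :
    HaltsWithin (M.checker.Step A) (Stuck (M.checker.Step A)) (t + 1) (compareCfg c f b z) := by
  refine haltsWithin_stuck_iff.2 fun D hD => ?_
  rcases step_compareCfg hc hD with ⟨d, hl, rfl⟩ | ⟨-, hD⟩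
  · exact ⟨t, t.lt_succ_self, h d hl⟩
  · exact ⟨0, t.succ_pos, stuck_of_state_eq_accept hD⟩

theorem haltsWithin_verifyCfg {c : M.Core} {f : TapePhase} {z : List M.PathSymbol} {n : ℕ}
    (hn : M.RunBound A c f none z n) :
    HaltsWithin (M.checker.Step A) (Stuck (M.checker.Step A)) (2 * z.length + n + 1)
      (verifyCfg c f z) := by
  induction z generalizing c f with
  | nil => exact haltsWithin_stuck_iff.2 fun D hD =>
      ⟨0, by omega, stuck_of_state_eq_accept (step_verifyCfg_nil hD).2⟩
  | cons x z ih =>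
    refine haltsWithin_stuck_iff.2 fun D hD => ?_
    rw [List.length_cons]
    obtain l | s := x
    · have hfollow {d : M.Core} (hl : M.LStep A c l d) :
          HaltsWithin (M.checker.Step A) (Stuck (M.checker.Step A)) (2 * z.length + n + 1)
            (verifyCfg d (f.after (labelRead l).toList) z) :=
        (ih fun v hv hf p e hp hreads =>
          (hn.load.tail hl (List.append_nil _).symm v hv hf p e hp hreads).trans n.pred_le)
      rcases step_verifyCfg_inl hD with ⟨d, hl, rfl⟩ | ⟨hc, b, rfl, rfl⟩ | ⟨-, hD⟩ | ⟨hf, rfl⟩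
      · exact ⟨_, by omega, hfollow hl⟩
      · exact ⟨_, by omega, haltsWithin_compareCfg hc fun d hl => hfollow hl⟩
      · exact ⟨0, by omega, stuck_of_state_eq_accept hD⟩
      · exact ⟨_, by omega, haltsWithin_rivalCfg hf hn.load⟩
    · rcases step_verifyCfg_inr hD with ⟨hc, rfl⟩ | ⟨-, hD⟩
      · exact ⟨_, by omega, ih (.of_mem_acc hc)⟩
      · exact ⟨0, by omega, stuck_of_state_eq_accept hD⟩

theorem step_checker_start_iff {z : List M.PathSymbol} {D : M.checker.Cfg} :
    M.checker.Step A (M.checker.start z) D ↔ D = verifyCfg M.coreStart .start z := by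
  constructor
  · intro h
    obtain ⟨a, i, hi, v, hv, rfl⟩ := h.exists_move rfl
    cases hv
    cases hi
    rfl
  · rintro rfl
    exact .move (P := M.checker) (q := .init) (a := some .leftEnd) (s := []) nofun rfl
      CheckerMove.init

theorem checker_linearTime {a b : ℕ} (hM : M.HasTimeBound a b) : M.checker.LinearTime := by
  refine ⟨a + 2, b + 2, fun A z => haltsWithin_stuck_iff.2 fun D hD => ?_⟩
  rw [step_checker_start_iff.1 hD]
  exact ⟨_, by linarith, haltsWithin_verifyCfg (hM.runBound A z)⟩

theorem checker_outputs_nonempty_iff {z : List M.PathSymbol} {x : List σ}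
    (hx : symReads z <+: inputTape x) : (M.checker.outputs A z).Nonempty ↔
      ¬ (symReads z = inputTape x ∧ M.EncodesLeast A M.coreStart z) := by
  have hstart : M.checker.AcceptsFrom A (M.checker.start z) ↔
      M.checker.AcceptsFrom A (verifyCfg M.coreStart .start z) := by
    refine ⟨fun h => ?_, fun h => h.head (step_checker_start_iff.2 rfl)⟩
    obtain ⟨D, hD, h⟩ := h.exists_step nofun
    rwa [step_checker_start_iff.1 hD] at h
  have hdone : TapePhase.start.after (symReads z) = .done ↔ symReads z = inputTape x :=
    ⟨TapePhase.eq_inputTape_of_after_eq_done hx, fun h => h ▸ TapePhase.start_after_inputTape x⟩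
  have hz : TapePhase.start.after (symReads z) ≠ .malformed :=
    TapePhase.after_ne_malformed_of_isPrefix hx (by rw [TapePhase.start_after_inputTape]; nofun)
  rw [← OracleProgram.acceptsFrom_start_iff, hstart, acceptsFrom_verifyCfg_iff hz, hdone]

end CheckerTime

end OracleNPDA

/-! ### The guesser -/

/-- A clock that starts with `m` units, loses one unit per letter and gains `a` units per tape
symbol read, does not run out along `z`; `r` gives the tape symbol read along with a letter. -/
def WithinClock {κ τ : Type} (r : κ → Option τ) (a m : ℕ) (z : List κ) : Prop :=
  ∀ u, u <+: z → u.length < m + a * (u.filterMap r).length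

section WithinClock

variable {κ τ : Type} {r : κ → Option τ} {a m : ℕ} {k : κ} {z : List κ}

theorem WithinClock.pos (h : WithinClock r a m z) : 0 < m := by
  simpa using h [] List.nil_prefix

theorem withinClock_nil (hm : 0 < m) : WithinClock r a m [] := by
  intro u hu
  obtain rfl := List.prefix_nil.1 hu
  simpa using hm

theorem withinClock_cons_iff : WithinClock r a (m + 1) (k :: z) ↔
    WithinClock r a (a * (r k).toList.length + m) z := by
  have hcons (u : List κ) : (k :: u).length < m + 1 + a * ((k :: u).filterMap r).length ↔
      u.length < a * (r k).toList.length + m + a * (u.filterMap r).length := by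
    rw [filterMap_cons_eq_append, List.length_append, List.length_cons, mul_add]
    omega
  constructor
  · exact fun h u hu => (hcons u).1 (h (k :: u) (List.cons_prefix_cons.2 ⟨rfl, hu⟩))
  · rintro h (_ | ⟨k', u⟩) hu
    · exact Nat.add_pos_left m.succ_pos _
    · obtain ⟨rfl, hz⟩ := List.cons_prefix_cons.1 hu
      exact (hcons u).2 (h u hz)

end WithinClock

/-- States of the program that guesses a word and asks whether it belongs to the oracle. -/
inductive GuesserState : Type
  | init
  | guess
  | ask
  | answer (b : Bool)

instance : Finite GuesserState :=
  Set.finite_univ_iff.1 <|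
    (Set.toFinite ({.init, .guess, .ask} ∪ Set.range .answer)).subset
      fun s _ => by cases s <;> simp

section Guesser

variable {σ γ κ : Type}

/-- The transitions of the program that guesses a word letter by letter; `r` and `w` give the tape
symbol that is read and the output symbol that is written along with a letter. The stack is the
clock of `WithinClock`. -/
inductive GuesserMove (r : κ → Option (TapeSymbol σ)) (w : κ → Option γ) (a b : ℕ) :
    GuesserState → Option (TapeSymbol σ) → Option Unit →
      GuesserState × List Unit × (Option γ × Option κ) → Prop
  | init : GuesserMove r w a b .init none none (.guess, List.replicate b (), (none, none))
  | guess (k : κ) : GuesserMove r w a b .guess (r k) (some ())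
      (.guess, List.replicate (a * (r k).toList.length) (), (w k, some k))
  | ask : GuesserMove r w a b .guess none (some ()) (.ask, [], (none, none))

theorem finite_guesserMove [Finite κ] (r : κ → Option (TapeSymbol σ)) (w : κ → Option γ) (a b : ℕ)
    (q : GuesserState) (i : Option (TapeSymbol σ)) (Z : Option Unit) :
    {v | GuesserMove r w a b q i Z v}.Finite := by
  let guessed (k : κ) : GuesserState × List Unit × (Option γ × Option κ) :=
    (.guess, List.replicate (a * (r k).toList.length) (), (w k, some k))
  refine (((Set.finite_range guessed).insert (.guess, List.replicate b (), (none, none))).insert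
    (.ask, [], (none, none))).subset ?_
  rintro v (_ | k | _)
  exacts [.inr (.inl rfl), .inr (.inr ⟨k, rfl⟩), .inl rfl]

/-- The program that guesses a word, asks whether it belongs to the oracle, and accepts if so. -/
abbrev guesser [Finite κ] (r : κ → Option (TapeSymbol σ)) (w : κ → Option γ) (a b : ℕ) :
    OracleProgram σ γ κ where
  Q := GuesserState
  Θ := Unit
  finite_Q := inferInstance
  finite_Θ := inferInstance
  δ q i Z := {v | GuesserMove r w a b q i Z v}
  finite_δ := finite_guesserMove r w a b
  q₀ := .init
  acc := {.answer true}
  ask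
    | .ask => some .answer
    | _ => none

variable [Finite κ] {r : κ → Option (TapeSymbol σ)} {w : κ → Option γ} {a b : ℕ} {B : Language κ}

/-- The configuration of the guesser in which `y` has been guessed, the output is `o`, the clock
allows for `m` more steps, and `i` is left to be read. -/
def guessCfg (r : κ → Option (TapeSymbol σ)) (w : κ → Option γ) (a b : ℕ)
    (i : List (TapeSymbol σ)) (m : ℕ) (y : List κ) (o : List γ) : (guesser r w a b).Cfg :=
  ⟨.guess, i, List.replicate m (), y, o⟩

theorem guesser_linearTime (r : κ → Option (TapeSymbol σ)) (w : κ → Option γ) (a b : ℕ) :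
    (guesser r w a b).LinearTime := by
  let potential (C : (guesser r w a b).Cfg) : ℕ :=
    match C.state with
    | .init => a * C.input.length + b + 3
    | .guess => C.stack.length + a * C.input.length + 2
    | .ask => 1
    | .answer _ => 0
  have hstep (B : Language κ) (C D : (guesser r w a b).Cfg) (h : (guesser r w a b).Step B C D) :
      potential D < potential C := by
    cases h with
    | @move q i s y z c q' u v hacc hask hδ =>
      change GuesserMove r w a b q c s.head? (q', u, v) at hδ
      generalize hZ : s.head? = Z at hδ
      cases hδ with
      | init =>
        obtain rfl := List.head?_eq_none_iff.1 hZ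
        simp only [potential, List.tail_nil, List.append_nil, List.length_replicate,
          Option.toList_none, List.nil_append]
        omega
      | guess k =>
        obtain ⟨s, rfl⟩ := List.head?_eq_some_iff.1 hZ
        simp only [potential, List.tail_cons, List.length_append, List.length_replicate,
          List.length_cons, mul_add]
        omega
      | ask =>
        simp only [potential]
        omega
    | @ask q i s y z next c hacc hask hb =>
      cases q <;> cases hask
      exact Nat.one_pos
  refine ⟨a, 2 * a + b + 3, fun B x => ?_⟩
  refine (haltsWithin_stuck_of_potential potential (hstep B) _).mono (le_of_eq ?_)
  change a * (inputTape x).length + b + 3 = _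
  simp only [inputTape, List.length_cons, List.length_append, List.length_map, List.length_nil]
  ring

theorem step_guesser_start_iff {x : List σ} {D : (guesser r w a b).Cfg} :
    (guesser r w a b).Step B ((guesser r w a b).start x) D ↔
      D = guessCfg r w a b (inputTape x) b [] [] := by
  have hstack : List.replicate b () ++ [] = List.replicate b () := List.append_nil _
  constructor
  · intro h
    obtain ⟨c, i, hi, v, hv, rfl⟩ := h.exists_move rfl
    cases hv
    obtain rfl : inputTape x = i := hi
    exact congrArg (OracleProgram.Cfg.mk _ _ · _ _) hstack
  · rintro rfl
    rw [guessCfg, ← hstack]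
    exact .move (P := guesser r w a b) (q := .init) (a := none) (s := []) nofun rfl
      GuesserMove.init

theorem step_guessCfg_iff {i : List (TapeSymbol σ)} {m : ℕ} {y : List κ} {o : List γ}
    {D : (guesser r w a b).Cfg} :
    (guesser r w a b).Step B (guessCfg r w a b i m y o) D ↔ ∃ n, m = n + 1 ∧
      (D = ⟨.ask, i, List.replicate n (), y, o⟩ ∨ ∃ k j, i = (r k).toList ++ j ∧
        D = guessCfg r w a b j (a * (r k).toList.length + n) (y ++ [k]) (o ++ (w k).toList)) := by
  constructor
  · intro h
    obtain ⟨c, j, hi, v, hv, rfl⟩ := h.exists_move rfl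
    change GuesserMove r w a b .guess c (List.replicate m ()).head? v at hv
    obtain rfl : i = c.toList ++ j := hi
    obtain _ | n := m
    · cases hv
    refine ⟨n, rfl, ?_⟩
    cases hv with
    | ask => exact .inl (by simp [guessCfg])
    | guess k =>
      exact .inr ⟨k, j, rfl, by simp [guessCfg, List.replicate_append_replicate]⟩
  · rintro ⟨n, rfl, rfl | ⟨k, j, rfl, rfl⟩⟩
    · have := OracleProgram.Step.move (P := guesser r w a b) (A := B) (q := .guess) (a := none)
        (i := i) (s := List.replicate (n + 1) ()) (y := y) (z := o) nofun rfl GuesserMove.ask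
      simpa [guessCfg] using this
    · have := OracleProgram.Step.move (P := guesser r w a b) (A := B) (q := .guess) (a := r k)
        (i := j) (s := List.replicate (n + 1) ()) (y := y) (z := o) nofun rfl
        (GuesserMove.guess k)
      simpa [guessCfg, List.replicate_append_replicate] using this

theorem mem_of_reflTransGen_ask {i : List (TapeSymbol σ)} {s : List Unit} {y : List κ}
    {o : List γ} {C : (guesser r w a b).Cfg} (hC : C.state = .answer true)
    (h : Relation.ReflTransGen ((guesser r w a b).Step B) ⟨.ask, i, s, y, o⟩ C) :
    y ∈ B ∧ C.output = o := by
  rcases h.cases_head with rfl | ⟨D, hD, h⟩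
  · cases hC
  obtain ⟨c, hc, rfl⟩ := hD.exists_answer rfl
  rcases h.cases_head with rfl | ⟨E, hE, -⟩
  · cases hC
    exact ⟨hc.1 rfl, rfl⟩
  · obtain ⟨_, _, _, _, hv, _⟩ := hE.exists_move rfl
    cases hv

theorem exists_of_reflTransGen_guessCfg {i : List (TapeSymbol σ)} {m : ℕ} {y : List κ}
    {o : List γ} {C : (guesser r w a b).Cfg} (hC : C.state = .answer true)
    (h : Relation.ReflTransGen ((guesser r w a b).Step B) (guessCfg r w a b i m y o) C) :
    ∃ z, y ++ z ∈ B ∧ z.filterMap r <+: i ∧ WithinClock r a m z ∧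
      C.output = o ++ z.filterMap w := by
  generalize hD : guessCfg r w a b i m y o = D at h
  induction h using Relation.ReflTransGen.head_induction_on generalizing i m y o with
  | refl =>
    subst hD
    cases hC
  | head hstep htail ih =>
    subst hD
    obtain ⟨n, rfl, rfl | ⟨k, j, rfl, rfl⟩⟩ := step_guessCfg_iff.1 hstep
    · obtain ⟨hy, ho⟩ := mem_of_reflTransGen_ask hC htail
      exact ⟨[], by rwa [List.append_nil], List.nil_prefix, withinClock_nil n.succ_pos,
        ho.trans (List.append_nil o).symm⟩
    · obtain ⟨z, hz, hr, hclock, hw⟩ := ih rfl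
      refine ⟨k :: z, by rwa [List.append_assoc] at hz, ?_, withinClock_cons_iff.2 hclock, ?_⟩
      · rw [filterMap_cons_eq_append]
        exact (List.prefix_append_right_inj _).2 hr
      · rw [hw, filterMap_cons_eq_append, List.append_assoc]

theorem exists_reflTransGen_guessCfg {i : List (TapeSymbol σ)} {m : ℕ} {y z : List κ}
    {o : List γ} (hz : y ++ z ∈ B) (hr : z.filterMap r <+: i) (hclock : WithinClock r a m z) :
    ∃ C : (guesser r w a b).Cfg, C.state = .answer true ∧ C.output = o ++ z.filterMap w ∧
      Relation.ReflTransGen ((guesser r w a b).Step B) (guessCfg r w a b i m y o) C := by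
  induction z generalizing i m y o with
  | nil =>
    obtain ⟨n, rfl⟩ := Nat.exists_eq_add_one.2 hclock.pos
    rw [List.append_nil] at hz
    refine ⟨⟨.answer true, i, List.replicate n (), [], o⟩, rfl, (List.append_nil o).symm, ?_⟩
    exact .tail (.single (step_guessCfg_iff.2 ⟨n, rfl, .inl rfl⟩))
      (.ask (P := guesser r w a b) (q := .ask) nofun rfl (iff_of_true rfl hz))
  | cons k z ih =>
    obtain ⟨n, rfl⟩ := Nat.exists_eq_add_one.2 hclock.pos
    rw [filterMap_cons_eq_append] at hr
    obtain ⟨j, rfl⟩ := (List.prefix_append _ _).trans hr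
    obtain ⟨C, hC, hw, h⟩ := ih (y := y ++ [k]) (o := o ++ (w k).toList)
      (by rwa [List.append_assoc]) ((List.prefix_append_right_inj _).1 hr)
      (withinClock_cons_iff.1 hclock)
    refine ⟨C, hC, by rw [hw, filterMap_cons_eq_append, List.append_assoc], h.head ?_⟩
    exact step_guessCfg_iff.2 ⟨n, rfl, .inr ⟨k, j, rfl, rfl⟩⟩

theorem mem_guesser_outputs_iff {x : List σ} {o : List γ} :
    o ∈ (guesser r w a b).outputs B x ↔ ∃ z ∈ B, z.filterMap r <+: inputTape x ∧
      WithinClock r a b z ∧ z.filterMap w = o := by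
  constructor
  · rintro ⟨C, hC, rfl, h⟩
    rcases h.cases_head with rfl | ⟨D, hD, h⟩
    · cases hC
    rw [step_guesser_start_iff.1 hD] at h
    obtain ⟨z, hz, hr, hclock, hw⟩ := exists_of_reflTransGen_guessCfg hC h
    exact ⟨z, hz, hr, hclock, hw.symm⟩
  · rintro ⟨z, hz, hr, hclock, rfl⟩
    obtain ⟨C, hC, hw, h⟩ := exists_reflTransGen_guessCfg (y := []) (w := w) (b := b) (o := []) hz
      hr hclock
    exact ⟨C, hC, hw, h.head (step_guesser_start_iff.2 rfl)⟩

end Guesser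

/-! ### The refinement -/

namespace OracleNPDA

variable {σ γ β : Type}

theorem accepts_iff_outputs_nonempty {M : OracleNPDA σ γ β} {A : Language β} {x : List σ} :
    M.Accepts A x ↔ (M.outputs A x).Nonempty :=
  ⟨fun ⟨c, hc, h⟩ => ⟨c.output, c, hc, rfl, h⟩, fun ⟨_, c, hc, _, h⟩ => ⟨c, hc, h⟩⟩

section LeastPath

variable {M : OracleNPDA σ γ β} [LinearOrder M.Label] {A : Language β}

/-- The values of the function computed by `M` that are written along least accepting paths. -/
def leastPathOutputs (M : OracleNPDA σ γ β) [LinearOrder M.Label] (A : Language β) :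
    MVFun σ γ := fun x =>
  {o | ∃ z, symReads z = inputTape x ∧ M.EncodesLeast A M.coreStart z ∧ symOuts z = o}

theorem EncodesLeast.withinClock {a b : ℕ} (hM : M.HasTimeBound a b) {x : List σ}
    {z : List M.PathSymbol} (hx : symReads z = inputTape x)
    (hz : M.EncodesLeast A M.coreStart z) : WithinClock symRead (a + 1) (b + 1) z := by
  obtain ⟨p, r, rfl, hp, -⟩ := hz
  exact fun _ hu => length_lt_of_isPrefix_encode hM hp.1 hx hu

theorem singleValued_leastPathOutputs : (M.leastPathOutputs A).SingleValued := by
  rintro x _ ⟨z, hx, hz, rfl⟩ _ ⟨z', hx', hz', rfl⟩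
  rw [hz.eq hz' (hx.trans hx'.symm)]

variable [Finite σ]

/-- The words that the checker accepts with the oracle `A`. Their complement is the oracle for the
guesser. -/
def refutedPaths (M : OracleNPDA σ γ β) [LinearOrder M.Label] (A : Language β) :
    Language M.PathSymbol := {z | (M.checker.outputs A z).Nonempty}

theorem refutedPaths_mem_CFLT {a b : ℕ} (hM : M.HasTimeBound a b) :
    M.refutedPaths A ∈ CFLT A M.PathSymbol :=
  ⟨M.checker.toOracleNPDA, OracleProgram.toOracleNPDA_linearTime (checker_linearTime hM),
    fun z => by rw [accepts_iff_outputs_nonempty, OracleProgram.toOracleNPDA_outputs]; rfl⟩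

theorem mem_compl_refutedPaths_iff {x : List σ} {z : List M.PathSymbol}
    (hx : symReads z <+: inputTape x) :
    z ∈ (M.refutedPaths A)ᶜ ↔ symReads z = inputTape x ∧ M.EncodesLeast A M.coreStart z :=
  (not_congr (checker_outputs_nonempty_iff hx)).trans not_not

theorem guesser_outputs_compl_refutedPaths {a b : ℕ} (hM : M.HasTimeBound a b) (x : List σ) :
    (guesser symRead symOut (a + 1) (b + 1)).outputs (M.refutedPaths A)ᶜ x =
      M.leastPathOutputs A x := by
  ext o
  rw [mem_guesser_outputs_iff]
  constructor
  · rintro ⟨z, hz, hx, -, ho⟩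
    obtain ⟨hx, hz⟩ := (mem_compl_refutedPaths_iff hx).1 hz
    exact ⟨z, hx, hz, ho⟩
  · rintro ⟨z, hx, hz, ho⟩
    have hprefix : symReads z <+: inputTape x := hx ▸ List.prefix_rfl
    exact ⟨z, (mem_compl_refutedPaths_iff hprefix).2 ⟨hx, hz⟩, hprefix, hz.withinClock hM hx, ho⟩

theorem leastPathOutputs_mem_CFLSVT [Finite γ] {a b : ℕ} (hM : M.HasTimeBound a b) :
    M.leastPathOutputs A ∈ CFLSVT (M.refutedPaths A)ᶜ σ γ := by
  refine ⟨⟨_, OracleProgram.toOracleNPDA_linearTime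
    (guesser_linearTime symRead symOut (a + 1) (b + 1)), fun x => ?_⟩,
    singleValued_leastPathOutputs⟩
  rw [OracleProgram.toOracleNPDA_outputs, guesser_outputs_compl_refutedPaths hM]

theorem leastPathOutputs_isRefinementOf {a b : ℕ} (hM : M.HasTimeBound a b) :
    (M.leastPathOutputs A).IsRefinementOf (M.outputs A) := by
  have hsub (x : List σ) : M.leastPathOutputs A x ⊆ M.outputs A x := by
    rintro _ ⟨_, hx, ⟨p, r, rfl, hp, -⟩, rfl⟩
    exact symOuts_mem_outputs hp.1 hx
  refine ⟨Set.Subset.antisymm (fun x hx => hx.mono (hsub x)) fun x hx => ?_, hsub⟩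
  obtain ⟨z, hz, hleast⟩ := exists_encodesLeast hM hx
  exact ⟨_, z, hz, hleast, rfl⟩

end LeastPath

end OracleNPDA

theorem exists_mem_CFLSVT_compl_isRefinementOf {σ γ β : Type} [Finite σ] [Finite γ]
    {A : Language β} {g : MVFun σ γ} (hg : g ∈ CFLMVT A σ γ) :
    ∃ (κ : Type) (_ : Finite κ) (L : Language κ), L ∈ CFLT A κ ∧
      ∃ f ∈ CFLSVT Lᶜ σ γ, f.IsRefinementOf g := by
  obtain ⟨M, ⟨a, b, hM⟩, hg⟩ := hg
  obtain rfl : g = M.outputs A := funext hg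
  classical
  let _ : LinearOrder M.Label := linearOrderOfSTO WellOrderingRel
  exact ⟨M.PathSymbol, inferInstance, M.refutedPaths A, OracleNPDA.refutedPaths_mem_CFLT hM,
    M.leastPathOutputs A, OracleNPDA.leastPathOutputs_mem_CFLSVT hM,
    OracleNPDA.leastPathOutputs_isRefinementOf hM⟩

end CFLHierarchy

theorem mainTheorem2_general {𝒞 : CFLHierarchy.LanguageFamily}
    (h𝒞 : ∀ (κ : Type) [Finite κ],
      CFLHierarchy.CFLTFamily 𝒞 κ ⊆ CFLHierarchy.coFamily 𝒞 κ) :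
    CFLHierarchy.FunctionClass.RefinedBy
      (CFLHierarchy.CFLMVTFamily 𝒞) (CFLHierarchy.CFLSVTFamily 𝒞) := by
  rintro σ γ _ _ g ⟨β, hβ, A, hA, hg⟩
  obtain ⟨κ, hκ, L, hL, f, hf, hfg⟩ := CFLHierarchy.exists_mem_CFLSVT_compl_isRefinementOf hg
  exact ⟨f, ⟨κ, hκ, Lᶜ, h𝒞 κ ⟨β, hβ, A, hA, hL⟩, hf⟩, hfg⟩

theorem mainTheorem2 (k : ℕ) (hk : 2 ≤ k)
    (hcollapse : CFLHierarchy.SigmaCFL k = CFLHierarchy.SigmaCFL (k + 1)) :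
    CFLHierarchy.FunctionClass.RefinedBy
      (CFLHierarchy.SigmaCFLMV (k + 1)) (CFLHierarchy.SigmaCFLSV (k + 1)) := by
  obtain ⟨m, rfl⟩ : ∃ m, k = m + 1 := ⟨k - 1, by lia⟩
  refine mainTheorem2_general fun κ _ L hL => ?_
  change Lᶜᶜ ∈ CFLHierarchy.SigmaCFL (m + 1) κ
  rwa [compl_compl, hcollapse]
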